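/- **Setting.** Let $\mathcal H$ be the Hopf algebra of rooted trees: the free commutative $\mathbb C$-algebra on the finite (non-planar) rooted trees, graded by the number of vertices, with $\Delta(B_+(F))=B_+(F)\otimes 1+(\mathrm{id}\otimes B_+)\Delta(F)$, where $B_+$ grafts a forest on a new root. Put $$t_1=B_+(1),\quad t_2=B_+(t_1),\quad t_3=B_+(t_2),\quad t_4=B_+(t_1t_1),\quad t_6=B_+(t_4),\quad t_7=B_+(t_1t_2),\quad t_8=B_+(t_1t_1t_1).$$ Let $\mathcal H^3\subset\mathcal H$ be the Hopf subalgebra generated by $t_1,t_2,t_3,t_4,t_6,t_7,t_8$ together with an arbitrary set of ladder trees. Let $f_1=t_1$ and $f_2=t_2-\tfrac12t_1^2$. Let $\mathcal A=\mathbb C((\lambda))=\mathcal A_-\oplus\mathcal A_+$ with $\mathcal A_-=\lambda^{-1}\mathbb C[\lambda^{-1}]$ and $\mathcal A_+=\mathbb C[[\lambda]]$, let $P_\pm$ be the projections onto $\mathcal A_\pm$, and let $R=P_+-P_-$. Let $\star$ be the convolution product of linear maps $\mathcal H^3\to\mathcal A$. A character is a unital algebra morphism $\varphi:\mathcal H^3\to\mathcal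 A$. It has a unique Birkhoff decomposition $\varphi=\varphi_-^{-1}\star\varphi_+$ with characters $\varphi_\pm$ such that $\varphi_+(x)\in\mathcal A_+$ for all $x$, and $\varphi_-(x)\in\mathcal A_-$ whenever $\varepsilon(x)=0$ ($\varepsilon$ the counit). For $s\in\mathbb C$ let $\varphi^s$ be the character with $\varphi^s(x)=e^{s\lambda|x|}\varphi(x)$ for homogeneous $x$ of degree $|x|$. The character $\varphi$ is *local* if $(\varphi^s)_-$ does not depend on $s$. An infinitesimal character is a linear map $Z:\mathcal H^3\to\mathcal A$ with $Z(xy)=Z(x)\varepsilon(y)+\varepsilon(x)Z(y)$. Write $[Z,Z']=Z\star Z'-Z'\star Z$. Let $\exp(Z)=\sum_{k\ge0}Z^{\star k}/k!$, a bijection from infinitesimal characters to characters, with inverse $\log(\varphi)=\sum_{k\ge1}(-1)^{k-1}(\varphi-\varepsilon)^{\star k}/k$. **Proposition.** Let $m,n\in\mathbb Z$ with $-n+2m=0$, and let $\varphi$ be a local character on $\mathcal H^3$. Let $L(t)$, $t\in\mathbb R$, be the solution in the infinitesimal characters of the Lax pair equation $$\frac{dL}{dt}=[L,M],\qquad M=\tfrac12R\big(f(L)\big),\qquad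 f(L)=2\lambda^{-n+2m}L,\qquad L(0)=\log(\varphi)$$ (the derivative being taken in each Laurent coefficient of $L(t)(x)$, for each $x$), and let $\chi_t=\exp(L(t))$. Then $\chi_t$ is local on $\mathcal H^3$ for all $t$ if and only if $$\varphi_-(f_1)=0\qquad\text{or}\qquad 3\,\varphi_-(f_1)\,\big(\varphi_+(f_2)\big|_{\lambda=0}\big)=\varphi_-(f_2)\,\big(\varphi_+(f_1)\big|_{\lambda=0}\big).$$ -/

import Mathlib

open scoped TensorProduct

namespace TreeHopf

/-! ## Rooted trees -/

/-- Finite planar rooted trees: a root together with the list of the subtrees hanging from it. -/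
inductive PlanarTree : Type
  | node : List PlanarTree → PlanarTree

/-- Elementary changes of planar embedding: permute the branches at one vertex. -/
inductive PlanarTree.Swap : PlanarTree → PlanarTree → Prop
  | perm {l m : List PlanarTree} : l.Perm m → Swap (.node l) (.node m)
  | child {a b : PlanarTree} (l r : List PlanarTree) :
      Swap a b → Swap (.node (l ++ a :: r)) (.node (l ++ b :: r))

/-- (Non-planar, non-empty, finite) rooted trees: planar rooted trees modulo the equivalence
relation generated by permutations of branches. -/
def RTree : Type := Quot PlanarTree.Swap

def RTree.mk (t : PlanarTree) : RTree := Quot.mk _ t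

/-- A chosen planar representative. -/
noncomputable def RTree.out (t : RTree) : PlanarTree := Quot.out t

theorem RTree.mk_out (t : RTree) : RTree.mk t.out = t := Quot.out_eq t

/-- The grafting of a forest (a finite multiset of rooted trees) on a new common root. -/
noncomputable def RTree.graft (F : Multiset RTree) : RTree :=
  RTree.mk (.node (F.toList.map RTree.out))

theorem RTree.mk_node_child {a b : PlanarTree} (l r : List PlanarTree)
    (h : RTree.mk a = RTree.mk b) :
    RTree.mk (.node (l ++ a :: r)) = RTree.mk (.node (l ++ b :: r)) := by
  have h' := Quot.eqvGen_exact h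
  induction h' with
  | rel a b hab => exact Quot.sound (.child l r hab)
  | refl a => rfl
  | symm a b _ ih => exact (ih (Quot.eqvGen_sound ‹_›)).symm
  | trans a b c h1 h2 ih1 ih2 =>
    exact (ih1 (Quot.eqvGen_sound h1)).trans (ih2 (Quot.eqvGen_sound h2))

theorem RTree.mk_node_of_map_eq (p : List PlanarTree) {l m : List PlanarTree}
    (h : l.map RTree.mk = m.map RTree.mk) :
    RTree.mk (.node (p ++ l)) = RTree.mk (.node (p ++ m)) := by
  induction l generalizing p m with
  | nil => cases m <;> simp_all
  | cons a l ih =>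
    cases m with
    | nil => simp at h
    | cons b m =>
      simp only [List.map_cons, List.cons.injEq] at h
      rw [RTree.mk_node_child p l h.1]
      have := ih (p ++ [b]) h.2
      simpa using this

theorem RTree.mk_node_congr {l m : List PlanarTree}
    (h : (l.map RTree.mk).Perm (m.map RTree.mk)) :
    RTree.mk (.node l) = RTree.mk (.node m) := by
  obtain ⟨l', hl, hm⟩ : ∃ l' : List PlanarTree,
      l'.Perm l ∧ l'.map RTree.mk = m.map RTree.mk := by
    have h' := h.symm
    rw [← show Relation.Comp (· = List.map RTree.mk ·) List.Perm (List.map RTree.mk m) l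
      = (List.map RTree.mk m).Perm (List.map RTree.mk l) from
        congrFun (congrFun (List.eq_map_comp_perm RTree.mk) _) _] at h'
    obtain ⟨l', h1, h2⟩ := h'
    exact ⟨l', h2, h1.symm⟩
  rw [← show RTree.mk (.node l') = RTree.mk (.node l) from Quot.sound (.perm hl)]
  simpa using RTree.mk_node_of_map_eq [] hm

theorem RTree.graft_map_mk (l : List PlanarTree) :
    RTree.graft (↑(l.map RTree.mk) : Multiset RTree) = RTree.mk (.node l) := by
  apply RTree.mk_node_congr
  simp only [List.map_map, Function.comp_def, RTree.mk_out, List.map_id']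
  exact Multiset.coe_eq_coe.1 (by simp)

mutual
  /-- The number of vertices. -/
  def PlanarTree.size : PlanarTree → ℕ
    | .node l => 1 + PlanarTree.sizeList l
  /-- The number of vertices of a planar forest. -/
  def PlanarTree.sizeList : List PlanarTree → ℕ
    | [] => 0
    | t :: l => PlanarTree.size t + PlanarTree.sizeList l
end

theorem PlanarTree.sizeList_eq (l : List PlanarTree) :
    PlanarTree.sizeList l = (l.map PlanarTree.size).sum := by
  induction l with
  | nil => simp [PlanarTree.sizeList]
  | cons a l ih => simp [PlanarTree.sizeList, ih]

theorem PlanarTree.size_swap {a b : PlanarTree} (h : PlanarTree.Swap a b) : a.size = b.size := by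
  induction h with
  | perm h =>
    simp only [PlanarTree.size, PlanarTree.sizeList_eq]
    rw [(h.map _).sum_eq]
  | child l r _ ih => simp [PlanarTree.size, PlanarTree.sizeList_eq, ih]

/-- The degree of a rooted tree: its number of vertices. -/
def RTree.deg : RTree → ℕ := Quot.lift PlanarTree.size fun _ _ h => PlanarTree.size_swap h

/-! ## The Hopf algebra of rooted trees -/

/-- The commutative algebra freely generated by the rooted trees; its monomials are the forests,
and the empty forest is `1`. -/
abbrev TreeAlg : Type := MvPolynomial RTree ℂ

/-- The linear operator `B₊` grafting each forest on a new root. -/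
noncomputable def Bplus : TreeAlg →ₗ[ℂ] TreeAlg :=
  (MvPolynomial.basisMonomials RTree ℂ).constr ℂ
    fun F => MvPolynomial.X (RTree.graft (Finsupp.toMultiset F))

mutual
  /-- The coproduct of a tree, by the recursion
  `Δ (B₊ F) = B₊ F ⊗ 1 + (id ⊗ B₊) (Δ F)`; equivalently, the sum over the admissible cuts of
  (pruned branches) `⊗` (part containing the root). -/
  noncomputable def PlanarTree.cop : PlanarTree → TreeAlg ⊗[ℂ] TreeAlg
    | .node l => MvPolynomial.X (RTree.mk (.node l)) ⊗ₜ[ℂ] 1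
        + LinearMap.lTensor TreeAlg Bplus (PlanarTree.copList l)
  /-- The coproduct of a forest: the product of the coproducts of its trees. -/
  noncomputable def PlanarTree.copList : List PlanarTree → TreeAlg ⊗[ℂ] TreeAlg
    | [] => 1
    | t :: l => PlanarTree.cop t * PlanarTree.copList l
end

theorem PlanarTree.copList_eq (l : List PlanarTree) :
    PlanarTree.copList l = (l.map PlanarTree.cop).prod := by
  induction l with
  | nil => simp [PlanarTree.copList]
  | cons a l ih => simp [PlanarTree.copList, ih]

theorem PlanarTree.cop_swap {a b : PlanarTree} (h : PlanarTree.Swap a b) : a.cop = b.cop := by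
  induction h with
  | @perm l m h =>
    have e : RTree.mk (.node l) = RTree.mk (.node m) := Quot.sound (.perm h)
    simp only [PlanarTree.cop, PlanarTree.copList_eq, e]
    rw [(h.map _).prod_eq]
  | @child a b l r h ih =>
    have e : RTree.mk (.node (l ++ a :: r)) = RTree.mk (.node (l ++ b :: r)) :=
      Quot.sound (.child l r h)
    simp only [PlanarTree.cop, PlanarTree.copList_eq, e, List.map_append, List.map_cons, ih]

/-- The coproduct of a rooted tree. -/
noncomputable def RTree.cop : RTree → TreeAlg ⊗[ℂ] TreeAlg :=
  Quot.lift PlanarTree.cop fun _ _ h => PlanarTree.cop_swap h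

/-- The coproduct of the Hopf algebra of rooted trees. -/
noncomputable def coproduct : TreeAlg →ₐ[ℂ] TreeAlg ⊗[ℂ] TreeAlg :=
  MvPolynomial.aeval RTree.cop

/-- The counit: it kills every non-empty forest. -/
noncomputable def counitHom : TreeAlg →ₐ[ℂ] ℂ := MvPolynomial.aeval fun _ => 0

theorem Bplus_monomial (F : RTree →₀ ℕ) :
    Bplus (MvPolynomial.monomial F 1) = MvPolynomial.X (RTree.graft (Finsupp.toMultiset F)) := by
  have := (MvPolynomial.basisMonomials RTree ℂ).constr_basis ℂ
    (fun F => (MvPolynomial.X (RTree.graft (Finsupp.toMultiset F)) : TreeAlg)) F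
  simpa [Bplus] using this

theorem Bplus_prod (F : Multiset RTree) :
    Bplus (F.map MvPolynomial.X).prod = MvPolynomial.X (RTree.graft F) := by
  classical
  have h : (F.map (MvPolynomial.X (R := ℂ))).prod
      = MvPolynomial.monomial (Multiset.toFinsupp F) 1 := by
    induction F using Multiset.induction with
    | empty => simp
    | cons a s ih =>
      rw [Multiset.map_cons, Multiset.prod_cons, ih, ← Multiset.singleton_add, map_add,
        Multiset.toFinsupp_singleton, MvPolynomial.X, MvPolynomial.monomial_mul, one_mul]
  rw [h, Bplus_monomial, Multiset.toFinsupp_toMultiset]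

theorem coproduct_mk (t : PlanarTree) :
    coproduct (MvPolynomial.X (RTree.mk t)) = t.cop := by
  rw [coproduct, MvPolynomial.aeval_X]
  rfl

theorem exists_planar (F : Multiset RTree) :
    ∃ l : List PlanarTree, F = (↑(l.map RTree.mk) : Multiset RTree) := by
  refine ⟨F.toList.map RTree.out, ?_⟩
  simp [Function.comp_def, RTree.mk_out]

theorem coproduct_graft (F : Multiset RTree) :
    coproduct (MvPolynomial.X (RTree.graft F)) = MvPolynomial.X (RTree.graft F) ⊗ₜ[ℂ] 1
      + LinearMap.lTensor TreeAlg Bplus (coproduct (F.map MvPolynomial.X).prod) := by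
  obtain ⟨l, rfl⟩ := exists_planar F
  rw [RTree.graft_map_mk, coproduct_mk, PlanarTree.cop, PlanarTree.copList_eq]
  congr 2
  rw [map_multiset_prod]
  simp [Function.comp_def, coproduct_mk]

theorem coproduct_Bplus (f : TreeAlg) :
    coproduct (Bplus f) = Bplus f ⊗ₜ[ℂ] 1
      + LinearMap.lTensor TreeAlg Bplus (coproduct f) := by
  have h : coproduct.toLinearMap ∘ₗ Bplus
      = (TensorProduct.mk ℂ TreeAlg TreeAlg).flip 1 ∘ₗ Bplus
        + LinearMap.lTensor TreeAlg Bplus ∘ₗ coproduct.toLinearMap := by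
    refine (MvPolynomial.basisMonomials RTree ℂ).ext fun F => ?_
    have e : (MvPolynomial.monomial F 1 : TreeAlg)
        = ((Finsupp.toMultiset F).map MvPolynomial.X).prod := by
      rw [Finsupp.toMultiset_map, Finsupp.prod_toMultiset, MvPolynomial.monomial_eq]
      simp [Finsupp.prod_mapDomain_index, pow_add]
    simp only [MvPolynomial.coe_basisMonomials, LinearMap.comp_apply, LinearMap.add_apply,
      AlgHom.toLinearMap_apply, LinearMap.flip_apply, TensorProduct.mk_apply]
    rw [e, Bplus_prod, coproduct_graft]
  exact LinearMap.congr_fun h f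

theorem counit_Bplus (f : TreeAlg) : counitHom (Bplus f) = 0 := by
  have h : counitHom.toLinearMap ∘ₗ Bplus = 0 := by
    refine (MvPolynomial.basisMonomials RTree ℂ).ext fun F => ?_
    simp [Bplus_monomial, counitHom]
  exact LinearMap.congr_fun h f

/-- An induction principle: a multiplicative property stable under grafting holds everywhere. -/
theorem algHom_ext_graft {B : Type*} [CommSemiring B] [Algebra ℂ B] {f g : TreeAlg →ₐ[ℂ] B}
    (h : ∀ x : TreeAlg, f x = g x → f (Bplus x) = g (Bplus x)) : f = g := by
  have key : ∀ t : PlanarTree,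
      f (MvPolynomial.X (RTree.mk t)) = g (MvPolynomial.X (RTree.mk t)) := by
    intro t
    induction t using PlanarTree.rec
      (motive_2 := fun l => f ((l.map fun t => (MvPolynomial.X (RTree.mk t) : TreeAlg)).prod)
        = g ((l.map fun t => (MvPolynomial.X (RTree.mk t) : TreeAlg)).prod)) with
    | node l ih =>
      have := h _ ih
      have e := Bplus_prod (↑(l.map RTree.mk) : Multiset RTree)
      rw [RTree.graft_map_mk] at e
      rw [← e]
      simpa [Function.comp_def] using this
    | nil => simp
    | cons a l ha hl => simp [ha, hl]
  refine MvPolynomial.algHom_ext fun t => ?_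
  rw [← RTree.mk_out t]
  exact key _

theorem coassoc_tree :
    (Algebra.TensorProduct.assoc ℂ ℂ ℂ TreeAlg TreeAlg TreeAlg).toAlgHom.comp
      ((Algebra.TensorProduct.map coproduct (.id ℂ TreeAlg)).comp coproduct)
      = (Algebra.TensorProduct.map (.id ℂ TreeAlg) coproduct).comp coproduct := by
  refine algHom_ext_graft (B := TreeAlg ⊗[ℂ] (TreeAlg ⊗[ℂ] TreeAlg)) (fun x hx => ?_)
  simp only [AlgHom.comp_apply] at hx ⊢
  have h1 : ∀ z : TreeAlg ⊗[ℂ] TreeAlg,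
      (Algebra.TensorProduct.map (.id ℂ TreeAlg) coproduct) (LinearMap.lTensor TreeAlg Bplus z)
        = (Algebra.TensorProduct.assoc ℂ ℂ ℂ TreeAlg TreeAlg TreeAlg)
            ((LinearMap.lTensor TreeAlg Bplus z) ⊗ₜ 1)
          + LinearMap.lTensor TreeAlg (LinearMap.lTensor TreeAlg Bplus)
            ((Algebra.TensorProduct.map (.id ℂ TreeAlg) coproduct) z) := by
    intro z
    induction z with
    | zero => simp
    | add a b ha hb => simp only [map_add, ha, hb, TensorProduct.add_tmul]; abel
    | tmul a b => simp [coproduct_Bplus, TensorProduct.tmul_add]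
  have h2 : ∀ z : TreeAlg ⊗[ℂ] TreeAlg,
      (Algebra.TensorProduct.assoc ℂ ℂ ℂ TreeAlg TreeAlg TreeAlg)
        ((Algebra.TensorProduct.map coproduct (.id ℂ TreeAlg))
          (LinearMap.lTensor TreeAlg Bplus z))
        = LinearMap.lTensor TreeAlg (LinearMap.lTensor TreeAlg Bplus)
          ((Algebra.TensorProduct.assoc ℂ ℂ ℂ TreeAlg TreeAlg TreeAlg)
            ((Algebra.TensorProduct.map coproduct (.id ℂ TreeAlg)) z)) := by
    intro z
    induction z with
    | zero => simp
    | add a b ha hb => simp only [map_add, ha, hb]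
    | tmul a b =>
      simp only [LinearMap.lTensor_tmul, Algebra.TensorProduct.map_tmul, AlgHom.id_apply]
      induction coproduct a with
      | zero => simp
      | add a b ha hb => simp only [TensorProduct.add_tmul, map_add, ha, hb]
      | tmul u v => simp
  have h3 := h1 (coproduct x)
  have h4 := h2 (coproduct x)
  have hx' : (Algebra.TensorProduct.assoc ℂ ℂ ℂ TreeAlg TreeAlg TreeAlg)
      ((Algebra.TensorProduct.map coproduct (.id ℂ TreeAlg)) (coproduct x))
      = (Algebra.TensorProduct.map (.id ℂ TreeAlg) coproduct) (coproduct x) := hx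
  rw [coproduct_Bplus]
  simp only [map_add]
  rw [h3, ← hx', ← h4, Algebra.TensorProduct.map_tmul, Algebra.TensorProduct.map_tmul,
    coproduct_Bplus]
  simp only [TensorProduct.add_tmul, map_add, map_one, AlgHom.id_apply, add_assoc]
  rfl

theorem rTensor_counit_tree :
    (Algebra.TensorProduct.map counitHom (.id ℂ TreeAlg)).comp coproduct
      = (Algebra.TensorProduct.lid ℂ TreeAlg).symm := by
  refine algHom_ext_graft fun x hx => ?_
  simp only [AlgHom.comp_apply] at hx ⊢
  have h1 : ∀ z : TreeAlg ⊗[ℂ] TreeAlg,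
      (Algebra.TensorProduct.map counitHom (.id ℂ TreeAlg)) (LinearMap.lTensor TreeAlg Bplus z)
        = LinearMap.lTensor ℂ Bplus
          ((Algebra.TensorProduct.map counitHom (.id ℂ TreeAlg)) z) := by
    intro z
    induction z with
    | zero => simp
    | add a b ha hb => simp only [map_add, ha, hb]
    | tmul a b => simp
  rw [coproduct_Bplus, map_add, h1, hx]
  simp [counit_Bplus]

theorem lTensor_counit_tree :
    (Algebra.TensorProduct.map (.id ℂ TreeAlg) counitHom).comp coproduct
      = (Algebra.TensorProduct.rid ℂ ℂ TreeAlg).symm := by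
  refine algHom_ext_graft fun x _ => ?_
  simp only [AlgHom.comp_apply]
  have h1 : ∀ z : TreeAlg ⊗[ℂ] TreeAlg,
      (Algebra.TensorProduct.map (.id ℂ TreeAlg) counitHom) (LinearMap.lTensor TreeAlg Bplus z)
        = 0 := by
    intro z
    induction z with
    | zero => simp
    | add a b ha hb => simp only [map_add, ha, hb, add_zero]
    | tmul a b => simp [counit_Bplus]
  rw [coproduct_Bplus, map_add, h1]
  simp

/-! ## Sub-bialgebras generated by trees -/

/-- The inclusion `K ⊗ K → H ⊗ H` for the subalgebra `K` generated by a set of trees. -/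
noncomputable def inclTensor (S : Set RTree) :
    MvPolynomial.supported ℂ S ⊗[ℂ] MvPolynomial.supported ℂ S →ₐ[ℂ] TreeAlg ⊗[ℂ] TreeAlg :=
  Algebra.TensorProduct.map (MvPolynomial.supported ℂ S).val (MvPolynomial.supported ℂ S).val

/-- The subalgebra `K` generated by `S` satisfies `Δ K ⊆ K ⊗ K`. -/
def CutClosed (S : Set RTree) : Prop :=
  ∀ t ∈ S, coproduct (MvPolynomial.X t) ∈ (inclTensor S).range

theorem inclTensor_injective (S : Set RTree) : Function.Injective (inclTensor S) :=
  TensorProduct.map_injective_of_flat_flat (MvPolynomial.supported ℂ S).val.toLinearMap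
    (MvPolynomial.supported ℂ S).val.toLinearMap Subtype.val_injective Subtype.val_injective

/-- A generating tree as an element of the subalgebra. -/
noncomputable def treeGen (S : Set RTree) (t : S) : MvPolynomial.supported ℂ S :=
  ⟨MvPolynomial.X t.1, Algebra.subset_adjoin ⟨t.1, t.2, rfl⟩⟩

theorem supported_algHom_ext {S : Set RTree} {B : Type*} [Semiring B] [Algebra ℂ B]
    {f g : MvPolynomial.supported ℂ S →ₐ[ℂ] B} (h : ∀ t : S, f (treeGen S t) = g (treeGen S t)) :
    f = g := by
  have h' : f.comp (MvPolynomial.supportedEquivMvPolynomial S).symm.toAlgHom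
      = g.comp (MvPolynomial.supportedEquivMvPolynomial S).symm.toAlgHom := by
    refine MvPolynomial.algHom_ext fun t => ?_
    have e : (MvPolynomial.supportedEquivMvPolynomial S).symm (MvPolynomial.X t : MvPolynomial S ℂ)
        = treeGen S t := Subtype.ext (MvPolynomial.supportedEquivMvPolynomial_symm_X S t)
    simpa [e] using h t
  ext x
  have := DFunLike.congr_fun h' (MvPolynomial.supportedEquivMvPolynomial S x)
  simpa using this

/-- The algebra morphism with prescribed values on the generating trees. -/
noncomputable def liftGen (S : Set RTree) {B : Type*} [CommSemiring B] [Algebra ℂ B] (v : S → B) :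
    MvPolynomial.supported ℂ S →ₐ[ℂ] B :=
  (MvPolynomial.aeval v).comp (MvPolynomial.supportedEquivMvPolynomial S).toAlgHom

theorem liftGen_treeGen (S : Set RTree) {B : Type*} [CommSemiring B] [Algebra ℂ B] (v : S → B)
    (t : S) : liftGen S v (treeGen S t) = v t := by
  have e : MvPolynomial.supportedEquivMvPolynomial S (treeGen S t)
      = (MvPolynomial.X t : MvPolynomial S ℂ) := by
    rw [← AlgEquiv.eq_symm_apply]
    exact Subtype.ext (MvPolynomial.supportedEquivMvPolynomial_symm_X S t).symm
  simp [liftGen, e]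

/-- The restriction of the coproduct. -/
noncomputable def subCoproduct {S : Set RTree} (hS : CutClosed S) :
    MvPolynomial.supported ℂ S →ₐ[ℂ]
      MvPolynomial.supported ℂ S ⊗[ℂ] MvPolynomial.supported ℂ S :=
  liftGen S fun t => (hS t.1 t.2).choose

/-- The restriction of the counit. -/
noncomputable def subCounit (S : Set RTree) : MvPolynomial.supported ℂ S →ₐ[ℂ] ℂ :=
  counitHom.comp (MvPolynomial.supported ℂ S).val

theorem inclTensor_comp_subCoproduct {S : Set RTree} (hS : CutClosed S) :
    (inclTensor S).comp (subCoproduct hS) = coproduct.comp (MvPolynomial.supported ℂ S).val := by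
  refine supported_algHom_ext fun t => ?_
  simp only [AlgHom.comp_apply, subCoproduct, liftGen_treeGen]
  exact (hS t.1 t.2).choose_spec

/-- A cut-closed set of trees generates a bialgebra, with the restricted coproduct and counit. -/
noncomputable abbrev subBialgebra {S : Set RTree} (hS : CutClosed S) :
    Bialgebra ℂ (MvPolynomial.supported ℂ S) := by
  have hΔ : ∀ x, inclTensor S (subCoproduct hS x) = coproduct (x : TreeAlg) := fun x =>
    DFunLike.congr_fun (inclTensor_comp_subCoproduct hS) x
  refine Bialgebra.ofAlgHom (subCoproduct hS) (subCounit S) ?_ ?_ ?_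
  · let J : MvPolynomial.supported ℂ S ⊗[ℂ]
        (MvPolynomial.supported ℂ S ⊗[ℂ] MvPolynomial.supported ℂ S) →ₐ[ℂ]
        TreeAlg ⊗[ℂ] (TreeAlg ⊗[ℂ] TreeAlg) :=
      Algebra.TensorProduct.map (MvPolynomial.supported ℂ S).val (inclTensor S)
    have hJ : Function.Injective J :=
      TensorProduct.map_injective_of_flat_flat (MvPolynomial.supported ℂ S).val.toLinearMap
        (inclTensor S).toLinearMap Subtype.val_injective (inclTensor_injective S)
    have h0 : ∀ w (b : MvPolynomial.supported ℂ S),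
        J ((Algebra.TensorProduct.assoc ℂ ℂ ℂ _ _ _) (w ⊗ₜ b))
          = (Algebra.TensorProduct.assoc ℂ ℂ ℂ TreeAlg TreeAlg TreeAlg)
            (inclTensor S w ⊗ₜ (b : TreeAlg)) := by
      intro w b
      induction w with
      | zero => simp
      | add u v hu hv => simp only [TensorProduct.add_tmul, map_add, hu, hv]
      | tmul u v => simp [J, inclTensor]
    have h1 : ∀ z, J ((Algebra.TensorProduct.assoc ℂ ℂ ℂ _ _ _)
        (Algebra.TensorProduct.map (subCoproduct hS) (.id ℂ _) z))
          = (Algebra.TensorProduct.assoc ℂ ℂ ℂ TreeAlg TreeAlg TreeAlg)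
            (Algebra.TensorProduct.map coproduct (.id ℂ _) (inclTensor S z)) := by
      intro z
      induction z with
      | zero => simp
      | add u v hu hv => simp only [map_add, hu, hv]
      | tmul u v =>
        rw [Algebra.TensorProduct.map_tmul, h0, hΔ]
        simp [inclTensor]
    have h2 : ∀ z, J (Algebra.TensorProduct.map (.id ℂ _) (subCoproduct hS) z)
          = Algebra.TensorProduct.map (.id ℂ _) coproduct (inclTensor S z) := by
      intro z
      induction z with
      | zero => simp
      | add u v hu hv => simp only [map_add, hu, hv]
      | tmul u v => simp [J, inclTensor, ← hΔ]
    refine AlgHom.ext fun x => hJ ?_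
    have e := DFunLike.congr_fun coassoc_tree (x : TreeAlg)
    have e1 := h1 (subCoproduct hS x)
    have e2 := h2 (subCoproduct hS x)
    rw [hΔ] at e1 e2
    exact e1.trans (e.trans e2.symm)
  · have hJ : Function.Injective (Algebra.TensorProduct.map (.id ℂ ℂ)
        (MvPolynomial.supported ℂ S).val) :=
      TensorProduct.map_injective_of_flat_flat LinearMap.id
        (MvPolynomial.supported ℂ S).val.toLinearMap Function.injective_id Subtype.val_injective
    have h1 : ∀ z, Algebra.TensorProduct.map (.id ℂ ℂ) (MvPolynomial.supported ℂ S).val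
        (Algebra.TensorProduct.map (subCounit S) (.id ℂ _) z)
          = Algebra.TensorProduct.map counitHom (.id ℂ _) (inclTensor S z) := by
      intro z
      induction z with
      | zero => simp
      | add u v hu hv => simp only [map_add, hu, hv]
      | tmul u v => simp [inclTensor, subCounit]
    refine AlgHom.ext fun x => hJ ?_
    have e := DFunLike.congr_fun rTensor_counit_tree (x : TreeAlg)
    have e1 := h1 (subCoproduct hS x)
    rw [hΔ] at e1
    refine e1.trans (e.trans ?_)
    simp
  · have hJ : Function.Injective (Algebra.TensorProduct.map
        (MvPolynomial.supported ℂ S).val (.id ℂ ℂ)) :=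
      TensorProduct.map_injective_of_flat_flat (MvPolynomial.supported ℂ S).val.toLinearMap
        LinearMap.id Subtype.val_injective Function.injective_id
    have h1 : ∀ z, Algebra.TensorProduct.map (MvPolynomial.supported ℂ S).val (.id ℂ ℂ)
        (Algebra.TensorProduct.map (.id ℂ _) (subCounit S) z)
          = Algebra.TensorProduct.map (.id ℂ _) counitHom (inclTensor S z) := by
      intro z
      induction z with
      | zero => simp
      | add u v hu hv => simp only [map_add, hu, hv]
      | tmul u v => simp [inclTensor, subCounit]
    refine AlgHom.ext fun x => hJ ?_
    have e := DFunLike.congr_fun lTensor_counit_tree (x : TreeAlg)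
    have e1 := h1 (subCoproduct hS x)
    rw [hΔ] at e1
    refine e1.trans (e.trans ?_)
    simp

/-! ## The Hopf subalgebra `H³` -/

/-- The ladder (chain) with `n + 1` vertices. -/
noncomputable def ladder : ℕ → RTree
  | 0 => RTree.graft 0
  | n + 1 => RTree.graft {ladder n}

/-- The one-vertex tree. -/
noncomputable def t1 : RTree := RTree.graft 0
/-- The ladder with two vertices. -/
noncomputable def t2 : RTree := RTree.graft {t1}
/-- The ladder with three vertices. -/
noncomputable def t3 : RTree := RTree.graft {t2}
/-- The root with two leaves. -/
noncomputable def t4 : RTree := RTree.graft {t1, t1}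
/-- The root with one branch `t4`. -/
noncomputable def t6 : RTree := RTree.graft {t4}
/-- The root with the two branches `t1` and `t2`. -/
noncomputable def t7 : RTree := RTree.graft {t1, t2}
/-- The root with three leaves. -/
noncomputable def t8 : RTree := RTree.graft {t1, t1, t1}

/-- The generating trees of `H³`: the seven trees above and a set of ladders. A set
`{ladder n | n ∈ N}` of ladders is enlarged by all shorter ladders, since these belong to the
Hopf subalgebra it generates. -/
def generators (N : Set ℕ) : Set RTree :=
  {t1, t2, t3, t4, t6, t7, t8} ∪ {t | ∃ n ∈ N, ∃ k ≤ n, t = ladder k}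

theorem coproduct_t1 : coproduct (MvPolynomial.X t1) =
    MvPolynomial.X t1 ⊗ₜ[ℂ] 1 + 1 ⊗ₜ[ℂ] MvPolynomial.X t1 := by
  have h := coproduct_graft 0
  have e := Bplus_prod 0
  rw [Multiset.map_zero, Multiset.prod_zero] at h e
  rw [map_one, Algebra.TensorProduct.one_def, LinearMap.lTensor_tmul, e] at h
  exact h

theorem Bplus_one : Bplus 1 = MvPolynomial.X t1 := by
  simpa [t1] using Bplus_prod 0

theorem Bplus_X (t : RTree) : Bplus (MvPolynomial.X t) = MvPolynomial.X (RTree.graft {t}) := by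
  simpa using Bplus_prod {t}

theorem Bplus_X_mul_X (s t : RTree) :
    Bplus (MvPolynomial.X s * MvPolynomial.X t) = MvPolynomial.X (RTree.graft {s, t}) := by
  simpa using Bplus_prod {s, t}

theorem Bplus_X_mul_X_mul_X (r s t : RTree) :
    Bplus (MvPolynomial.X r * (MvPolynomial.X s * MvPolynomial.X t))
      = MvPolynomial.X (RTree.graft {r, s, t}) := by
  simpa using Bplus_prod {r, s, t}

theorem coproduct_t2 : coproduct (MvPolynomial.X t2) =
    MvPolynomial.X t2 ⊗ₜ[ℂ] 1 + MvPolynomial.X t1 ⊗ₜ[ℂ] MvPolynomial.X t1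
      + 1 ⊗ₜ[ℂ] MvPolynomial.X t2 := by
  have h := coproduct_Bplus (MvPolynomial.X t1)
  rw [Bplus_X, coproduct_t1] at h
  simp only [map_add, LinearMap.lTensor_tmul, Bplus_one, Bplus_X] at h
  rw [t2, h, add_assoc]

theorem coproduct_t3 : coproduct (MvPolynomial.X t3) =
    MvPolynomial.X t3 ⊗ₜ[ℂ] 1 + MvPolynomial.X t2 ⊗ₜ[ℂ] MvPolynomial.X t1
      + MvPolynomial.X t1 ⊗ₜ[ℂ] MvPolynomial.X t2 + 1 ⊗ₜ[ℂ] MvPolynomial.X t3 := by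
  have h := coproduct_Bplus (MvPolynomial.X t2)
  rw [Bplus_X, coproduct_t2] at h
  simp only [map_add, LinearMap.lTensor_tmul, Bplus_one, Bplus_X] at h
  rw [t3, h]
  simp only [t2, add_assoc]

theorem coproduct_t4 : coproduct (MvPolynomial.X t4) =
    MvPolynomial.X t4 ⊗ₜ[ℂ] 1 + (MvPolynomial.X t1 * MvPolynomial.X t1) ⊗ₜ[ℂ] MvPolynomial.X t1
      + (2 : ℂ) • MvPolynomial.X t1 ⊗ₜ[ℂ] MvPolynomial.X t2
      + 1 ⊗ₜ[ℂ] MvPolynomial.X t4 := by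
  have h := coproduct_Bplus (MvPolynomial.X t1 * MvPolynomial.X t1)
  rw [Bplus_X_mul_X, map_mul, coproduct_t1] at h
  simp only [map_add, mul_add, add_mul, Algebra.TensorProduct.tmul_mul_tmul, mul_one, one_mul,
    LinearMap.lTensor_tmul, Bplus_one, Bplus_X, Bplus_X_mul_X] at h
  rw [t4, h, t2, two_smul]
  abel

theorem coproduct_t6 : coproduct (MvPolynomial.X t6) =
    MvPolynomial.X t6 ⊗ₜ[ℂ] 1 + MvPolynomial.X t4 ⊗ₜ[ℂ] MvPolynomial.X t1
      + (MvPolynomial.X t1 * MvPolynomial.X t1) ⊗ₜ[ℂ] MvPolynomial.X t2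
      + (2 : ℂ) • MvPolynomial.X t1 ⊗ₜ[ℂ] MvPolynomial.X t3
      + 1 ⊗ₜ[ℂ] MvPolynomial.X t6 := by
  have h := coproduct_Bplus (MvPolynomial.X t4)
  rw [Bplus_X, coproduct_t4] at h
  simp only [map_add, map_smul, LinearMap.lTensor_tmul, Bplus_one, Bplus_X] at h
  rw [t6, h]
  simp only [t2, t3, add_assoc]

theorem coproduct_t7 : coproduct (MvPolynomial.X t7) =
    MvPolynomial.X t7 ⊗ₜ[ℂ] 1 + (MvPolynomial.X t1 * MvPolynomial.X t2) ⊗ₜ[ℂ] MvPolynomial.X t1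
      + (MvPolynomial.X t1 * MvPolynomial.X t1) ⊗ₜ[ℂ] MvPolynomial.X t2
      + MvPolynomial.X t2 ⊗ₜ[ℂ] MvPolynomial.X t2
      + MvPolynomial.X t1 ⊗ₜ[ℂ] MvPolynomial.X t3
      + MvPolynomial.X t1 ⊗ₜ[ℂ] MvPolynomial.X t4
      + 1 ⊗ₜ[ℂ] MvPolynomial.X t7 := by
  have h := coproduct_Bplus (MvPolynomial.X t1 * MvPolynomial.X t2)
  rw [Bplus_X_mul_X, map_mul, coproduct_t1, coproduct_t2] at h
  simp only [map_add, mul_add, add_mul, Algebra.TensorProduct.tmul_mul_tmul, mul_one, one_mul,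
    LinearMap.lTensor_tmul, Bplus_one, Bplus_X, Bplus_X_mul_X] at h
  rw [← t2, ← t3, ← t4, ← t7] at h
  rw [h]
  abel

theorem coproduct_t8 : coproduct (MvPolynomial.X t8) =
    MvPolynomial.X t8 ⊗ₜ[ℂ] 1
      + (MvPolynomial.X t1 * (MvPolynomial.X t1 * MvPolynomial.X t1)) ⊗ₜ[ℂ] MvPolynomial.X t1
      + (3 : ℂ) • (MvPolynomial.X t1 * MvPolynomial.X t1) ⊗ₜ[ℂ] MvPolynomial.X t2
      + (3 : ℂ) • MvPolynomial.X t1 ⊗ₜ[ℂ] MvPolynomial.X t4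
      + 1 ⊗ₜ[ℂ] MvPolynomial.X t8 := by
  have h := coproduct_Bplus (MvPolynomial.X t1 * (MvPolynomial.X t1 * MvPolynomial.X t1))
  rw [Bplus_X_mul_X_mul_X, map_mul coproduct, map_mul coproduct, coproduct_t1] at h
  simp only [map_add, mul_add, add_mul, Algebra.TensorProduct.tmul_mul_tmul, mul_one, one_mul,
    LinearMap.lTensor_tmul, Bplus_one, Bplus_X, Bplus_X_mul_X, Bplus_X_mul_X_mul_X] at h
  rw [← t2, ← t4, ← t8] at h
  rw [h]
  have e3 : (3 : ℂ) = 1 + 1 + 1 := by norm_num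
  rw [e3]
  simp only [add_smul, one_smul]
  abel

theorem coproduct_ladder (n : ℕ) : coproduct (MvPolynomial.X (ladder n)) =
    MvPolynomial.X (ladder n) ⊗ₜ[ℂ] 1 + 1 ⊗ₜ[ℂ] MvPolynomial.X (ladder n)
      + ∑ i ∈ Finset.range n,
        MvPolynomial.X (ladder i) ⊗ₜ[ℂ] MvPolynomial.X (ladder (n - 1 - i)) := by
  induction n with
  | zero => simpa [ladder, t1] using coproduct_t1
  | succ n ih =>
    have h := coproduct_Bplus (MvPolynomial.X (ladder n))
    rw [Bplus_X, ih] at h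
    simp only [map_add, map_sum, LinearMap.lTensor_tmul, Bplus_one, Bplus_X] at h
    rw [ladder, h, Finset.sum_range_succ]
    have : ∀ i ∈ Finset.range n, (MvPolynomial.X (ladder i) : TreeAlg) ⊗ₜ[ℂ]
        (MvPolynomial.X (RTree.graft {ladder (n - 1 - i)}) : TreeAlg)
          = MvPolynomial.X (ladder i) ⊗ₜ[ℂ] MvPolynomial.X (ladder (n + 1 - 1 - i)) := by
      intro i hi
      have : n + 1 - 1 - i = (n - 1 - i) + 1 := by
        have := Finset.mem_range.1 hi
        omega
      rw [this, ladder]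
    rw [Finset.sum_congr rfl this]
    simp only [Nat.add_sub_cancel, Nat.sub_self, show ladder 0 = t1 from rfl]
    abel

theorem cutClosed_generators (N : Set ℕ) : CutClosed (generators N) := by
  have hX : ∀ t ∈ generators N, ∃ u : MvPolynomial.supported ℂ (generators N),
      (u : TreeAlg) = MvPolynomial.X t := fun t ht => ⟨treeGen _ ⟨t, ht⟩, rfl⟩
  have tm : ∀ a ∈ MvPolynomial.supported ℂ (generators N),
      ∀ b ∈ MvPolynomial.supported ℂ (generators N),
      a ⊗ₜ[ℂ] b ∈ (inclTensor (generators N)).range := by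
    intro a ha b hb
    exact ⟨⟨a, ha⟩ ⊗ₜ ⟨b, hb⟩, by simp [inclTensor]⟩
  have mX : ∀ t ∈ generators N, (MvPolynomial.X t : TreeAlg)
      ∈ MvPolynomial.supported ℂ (generators N) :=
    fun t ht => MvPolynomial.X_mem_supported.2 ht
  have m1 := mX t1 (by simp [generators])
  have m2 := mX t2 (by simp [generators])
  have m3 := mX t3 (by simp [generators])
  have m4 := mX t4 (by simp [generators])
  have m6 := mX t6 (by simp [generators])
  have m7 := mX t7 (by simp [generators])
  have m8 := mX t8 (by simp [generators])
  have m0 := one_mem (MvPolynomial.supported ℂ (generators N))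
  have m11 := mul_mem m1 m1
  have m12 := mul_mem m1 m2
  have m111 := mul_mem m1 m11
  rintro t (ht | ⟨n, hn, k, hk, rfl⟩)
  · simp only [Set.mem_insert_iff, Set.mem_singleton_iff] at ht
    rcases ht with rfl | rfl | rfl | rfl | rfl | rfl | rfl
    · rw [coproduct_t1]
      exact add_mem (tm _ m1 _ m0) (tm _ m0 _ m1)
    · rw [coproduct_t2]
      exact add_mem (add_mem (tm _ m2 _ m0) (tm _ m1 _ m1)) (tm _ m0 _ m2)
    · rw [coproduct_t3]
      exact add_mem (add_mem (add_mem (tm _ m3 _ m0) (tm _ m2 _ m1)) (tm _ m1 _ m2))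
        (tm _ m0 _ m3)
    · rw [coproduct_t4]
      exact add_mem (add_mem (add_mem (tm _ m4 _ m0) (tm _ m11 _ m1))
        (Subalgebra.smul_mem _ (tm _ m1 _ m2) _)) (tm _ m0 _ m4)
    · rw [coproduct_t6]
      exact add_mem (add_mem (add_mem (add_mem (tm _ m6 _ m0) (tm _ m4 _ m1)) (tm _ m11 _ m2))
        (Subalgebra.smul_mem _ (tm _ m1 _ m3) _)) (tm _ m0 _ m6)
    · rw [coproduct_t7]
      exact add_mem (add_mem (add_mem (add_mem (add_mem (add_mem (tm _ m7 _ m0) (tm _ m12 _ m1))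
        (tm _ m11 _ m2)) (tm _ m2 _ m2)) (tm _ m1 _ m3)) (tm _ m1 _ m4)) (tm _ m0 _ m7)
    · rw [coproduct_t8]
      exact add_mem (add_mem (add_mem (add_mem (tm _ m8 _ m0) (tm _ m111 _ m1))
        (Subalgebra.smul_mem _ (tm _ m11 _ m2) _)) (Subalgebra.smul_mem _ (tm _ m1 _ m4) _))
        (tm _ m0 _ m8)
  · have ml : ∀ j ≤ k, (MvPolynomial.X (ladder j) : TreeAlg)
        ∈ MvPolynomial.supported ℂ (generators N) :=
      fun j hj => mX _ (Or.inr ⟨n, hn, j, hj.trans hk, rfl⟩)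
    rw [coproduct_ladder]
    refine add_mem (add_mem (tm _ (ml k le_rfl) _ m0) (tm _ m0 _ (ml k le_rfl))) (sum_mem ?_)
    intro i hi
    have := Finset.mem_range.1 hi
    exact tm _ (ml i this.le) _ (ml _ (by omega))

/-- The Hopf subalgebra `H³` of the Hopf algebra of rooted trees. -/
noncomputable abbrev H3 (N : Set ℕ) : Subalgebra ℂ TreeAlg :=
  MvPolynomial.supported ℂ (generators N)

noncomputable instance bialgebraH3 (N : Set ℕ) : Bialgebra ℂ (H3 N) :=
  subBialgebra (cutClosed_generators N)

/-! ## Characters with values in Laurent series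

`K` stands for a connected graded commutative Hopf algebra. The products, powers and brackets of
functionals `K → ℂ((λ))` are those of Mathlib's convolution rings `WithConv`. -/

/-- The algebra `ℂ((λ))` of formal Laurent series, with its coefficientwise algebra structure. (A
synonym of `LaurentSeries ℂ`, on which Mathlib has several competing `ℂ`-algebra structures.) -/
def Laurent : Type := LaurentSeries ℂ

noncomputable instance Laurent.commRing : CommRing Laurent :=
  inferInstanceAs (CommRing (LaurentSeries ℂ))

noncomputable instance Laurent.algebra : Algebra ℂ Laurent :=
  (HahnSeries.instAlgebra : Algebra ℂ (LaurentSeries ℂ))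

/-- The coefficient of `λ^k`. -/
def Laurent.coeff (a : Laurent) (k : ℤ) : ℂ := HahnSeries.coeff a k

/-- The Laurent series `c λ^k`. -/
noncomputable def Laurent.single (k : ℤ) (c : ℂ) : Laurent :=
  (HahnSeries.single k c : LaurentSeries ℂ)

section General

variable {K : Type} [CommRing K] [Bialgebra ℂ K]

/-- The polar part `P₋` of a Laurent series. -/
noncomputable def polarPart : Laurent →ₗ[ℂ] Laurent :=
  (HahnSeries.truncLTLinearMap ℂ 0 : LaurentSeries ℂ →ₗ[ℂ] LaurentSeries ℂ)

/-- The holomorphic part `P₊` of a Laurent series. -/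
noncomputable def holPart : Laurent →ₗ[ℂ] Laurent :=
  LinearMap.id - polarPart

/-- Birkhoff decomposition `φ = φ₋⁻¹ ⋆ φ₊` of a character, written as `φ₋ ⋆ φ = φ₊`: the character
`φ₊` is holomorphic in `λ`, and `φ₋` takes values in `λ⁻¹ ℂ[λ⁻¹]` on the augmentation ideal. -/
structure IsBirkhoff (φ φm φp : K →ₐ[ℂ] Laurent) : Prop where
  polar : ∀ x : K, Coalgebra.counit (R := ℂ) x = 0 → ∀ k : ℤ, 0 ≤ k → (φm x).coeff k = 0
  holomorphic : ∀ x : K, ∀ k : ℤ, k < 0 → (φp x).coeff k = 0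
  factor : WithConv.toConv φm * WithConv.toConv φ = WithConv.toConv φp

/-- Infinitesimal characters. -/
def IsInfinitesimalCharacter (Z : WithConv (K →ₗ[ℂ] Laurent)) : Prop :=
  ∀ x y : K, Z (x * y) = Coalgebra.counit (R := ℂ) y • Z x + Coalgebra.counit (R := ℂ) x • Z y

/-- `χ = exp Z = ∑ₖ Z^{⋆k} / k!`. On each element of a connected graded Hopf algebra only finitely
many terms are nonzero, so the partial sums are eventually constant. -/
def IsExp (Z : WithConv (K →ₗ[ℂ] Laurent)) (χ : K →ₐ[ℂ] Laurent) : Prop :=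
  ∀ x : K, ∀ᶠ n : ℕ in Filter.atTop,
    ∑ k ∈ Finset.range n, ((k.factorial : ℂ)⁻¹) • (Z ^ k) x = χ x

/-- `Z = log φ = ∑_{k ≥ 1} (-1)^{k-1} (φ - ε)^{⋆k} / k`, again a sum with finitely many nonzero terms
on each element; `ε`, the unit of the convolution ring, is written `1`. -/
def IsLog (φ : K →ₐ[ℂ] Laurent) (Z : WithConv (K →ₗ[ℂ] Laurent)) : Prop :=
  ∀ x : K, ∀ᶠ n : ℕ in Filter.atTop,
    ∑ k ∈ Finset.Ico 1 n, ((-1 : ℂ) ^ (k - 1) / (k : ℂ)) •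
      ((WithConv.toConv φ.toLinearMap - 1) ^ k : WithConv (K →ₗ[ℂ] Laurent)) x = Z x

/-- The covariant map `f(L) = 2 λ^{-n+2m} L`. -/
noncomputable def covMap (m n : ℤ) (L : WithConv (K →ₗ[ℂ] Laurent)) :
    WithConv (K →ₗ[ℂ] Laurent) :=
  WithConv.toConv
    (LinearMap.mulLeft ℂ (Laurent.single (-n + 2 * m) 2) ∘ₗ L.ofConv)

/-- The operator `R = P₊ - P₋`, acting on the values of a functional. -/
noncomputable def opR (L : WithConv (K →ₗ[ℂ] Laurent)) :
    WithConv (K →ₗ[ℂ] Laurent) :=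
  WithConv.toConv ((holPart - polarPart) ∘ₗ L.ofConv)

/-- `M = (1/2) R(f(L))`. -/
noncomputable def laxM (m n : ℤ) (L : WithConv (K →ₗ[ℂ] Laurent)) :
    WithConv (K →ₗ[ℂ] Laurent) :=
  (1 / 2 : ℂ) • opR (covMap m n L)

/-- `L(t)` is a curve of infinitesimal characters with `dL/dt = [L, M]`, `M = (1/2) R(f(L))`, where
`f(L) = 2 λ^{-n+2m} L`; the derivative is taken on each element, in each Laurent coefficient. -/
structure IsLaxSolution (m n : ℤ) (L : ℝ → WithConv (K →ₗ[ℂ] Laurent)) : Prop where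
  infinitesimal : ∀ t, IsInfinitesimalCharacter (L t)
  lax : ∀ (t : ℝ) (x : K) (k : ℤ), HasDerivAt (fun τ : ℝ => (L τ x).coeff k)
    (((L t * laxM m n (L t) - laxM m n (L t) * L t) x).coeff k) t

end General

/-! ## Locality on `H³` -/

/-- The Laurent series `e^{cλ}`. -/
noncomputable def expSeries (c : ℂ) : Laurent :=
  (HahnSeries.ofPowerSeries ℤ ℂ (PowerSeries.rescale c (PowerSeries.exp ℂ)) : LaurentSeries ℂ)

/-- The character `φˢ`, with `φˢ(x) = e^{sλ|x|} φ(x)` for homogeneous `x` of degree `|x|`. Being a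
character, it is given by its values on the generating trees; see `scale_homogeneous`. -/
noncomputable def scale {N : Set ℕ} (s : ℂ) (φ : H3 N →ₐ[ℂ] Laurent) :
    H3 N →ₐ[ℂ] Laurent :=
  liftGen (generators N) fun t => expSeries (s * t.1.deg) * φ (treeGen (generators N) t)

theorem expSeries_add (a b : ℂ) : expSeries (a + b) = expSeries a * expSeries b := by
  rw [expSeries, ← PowerSeries.exp_mul_exp_eq_exp_add, map_mul]
  rfl

theorem expSeries_zero : expSeries 0 = 1 := by
  simp [expSeries, PowerSeries.rescale_zero]
  rfl

theorem scale_homogeneous {N : Set ℕ} (s : ℂ) (φ : H3 N →ₐ[ℂ] Laurent) (x : H3 N) (d : ℕ)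
    (hx : MvPolynomial.IsWeightedHomogeneous RTree.deg (x : TreeAlg) d) :
    scale s φ x = expSeries (s * d) * φ x := by
  classical
  obtain ⟨p, rfl⟩ := (MvPolynomial.supportedEquivMvPolynomial (generators N)).symm.surjective x
  have hp : ((MvPolynomial.supportedEquivMvPolynomial (generators N)).symm p : TreeAlg)
      = MvPolynomial.rename (Subtype.val : generators N → RTree) p := by
    have h : (MvPolynomial.supported ℂ (generators N)).val.comp
        (MvPolynomial.supportedEquivMvPolynomial (generators N)).symm.toAlgHom
        = MvPolynomial.rename (Subtype.val : generators N → RTree) :=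
      MvPolynomial.algHom_ext fun t => by
        rw [MvPolynomial.rename_X]
        exact MvPolynomial.supportedEquivMvPolynomial_symm_X _ t
    exact DFunLike.congr_fun h p
  rw [hp] at hx
  have hφ : φ ((MvPolynomial.supportedEquivMvPolynomial (generators N)).symm p)
      = MvPolynomial.aeval (fun t => φ (treeGen (generators N) t)) p := by
    have : φ = liftGen (generators N) (fun t => φ (treeGen (generators N) t)) :=
      supported_algHom_ext fun t =>
        (liftGen_treeGen (generators N) (fun t => φ (treeGen (generators N) t)) t).symm
    conv_lhs => rw [this]
    simp [liftGen]
  rw [hφ]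
  simp only [scale, liftGen, AlgHom.comp_apply, AlgEquiv.coe_toAlgHom, AlgEquiv.apply_symm_apply,
    MvPolynomial.aeval_def, MvPolynomial.eval₂_eq, Finset.mul_sum]
  refine Finset.sum_congr rfl fun e he => ?_
  have hdeg : (∑ t ∈ e.support, e t * t.1.deg) = d := by
    have h1 : MvPolynomial.coeff (e.mapDomain (Subtype.val : generators N → RTree))
        (MvPolynomial.rename (Subtype.val : generators N → RTree) p) ≠ 0 := by
      rw [MvPolynomial.coeff_rename_mapDomain _ Subtype.val_injective]
      exact MvPolynomial.mem_support_iff.1 he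
    have h2 := hx h1
    rw [Finsupp.weight_apply, Finsupp.sum_mapDomain_index (by simp) (by simp [add_mul])] at h2
    simpa [Finsupp.sum] using h2
  have hprod : ∀ u : Finset (generators N),
      ∏ t ∈ u, (expSeries (s * t.1.deg) * φ (treeGen (generators N) t)) ^ e t
        = expSeries (s * ((∑ t ∈ u, e t * t.1.deg : ℕ) : ℂ))
          * ∏ t ∈ u, φ (treeGen (generators N) t) ^ e t := by
    have hpow : ∀ (c : ℂ) (k : ℕ), expSeries c ^ k = expSeries (k * c) := by
      intro c k
      induction k with
      | zero => simp [expSeries_zero]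
      | succ k ih => rw [pow_succ, ih, ← expSeries_add]; congr 1; push_cast; ring
    intro u
    induction u using Finset.induction_on with
    | empty => simp [expSeries_zero]
    | insert a u ha ih =>
      rw [Finset.prod_insert ha, Finset.prod_insert ha, Finset.sum_insert ha, ih, mul_pow, hpow]
      have : s * ((e a * a.1.deg + ∑ t ∈ u, e t * t.1.deg : ℕ) : ℂ)
          = e a * (s * a.1.deg) + s * ((∑ t ∈ u, e t * t.1.deg : ℕ) : ℂ) := by
        push_cast; ring
      rw [this, expSeries_add]
      ring
  rw [hprod, hdeg]
  ring

/-- A character of `H³` is local if the negative part of the Birkhoff decomposition of `φˢ` does not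
depend on `s`. -/
def IsLocal {N : Set ℕ} (φ : H3 N →ₐ[ℂ] Laurent) : Prop :=
  ∃ ψ : H3 N →ₐ[ℂ] Laurent, ∀ s : ℂ, ∃ φp : H3 N →ₐ[ℂ] Laurent,
    IsBirkhoff (scale s φ) ψ φp

/-- The first normal coordinate `f₁ = t₁`. -/
noncomputable def f1 (N : Set ℕ) : H3 N := treeGen (generators N) ⟨t1, by simp [generators]⟩

/-- The second normal coordinate `f₂ = t₂ - t₁² / 2`. -/
noncomputable def f2 (N : Set ℕ) : H3 N :=
  treeGen (generators N) ⟨t2, by simp [generators]⟩ - (1 / 2 : ℂ) • (f1 N * f1 N)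

end TreeHopf

-- Write `x, y, z, w` for the values of `log φ` on `t₁, t₂, t₃, t₄`, and `a₋, a₊` for the polar and
-- holomorphic parts of a Laurent series `a`.
--
-- The flow. Since `-n + 2m = 0`, the Lax equation is `dL/dt = [L, R L]`. Infinitesimal characters
-- kill products of augmentation elements, so on a generator only the part of the coproduct that is
-- linear in both factors contributes. For ladders this part is symmetric and `L` stays constant. On
-- `t₄` the derivative is the constant `C = 2 (x R y - R x y)`, so `L` is affine in `t`. On `t₆, t₇,
-- t₈` the derivative is affine, so `L` is quadratic. Exponentiating, `χ_t` differs from `φ` only on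
-- `t₄, t₆, t₇, t₈`, by explicit series `d₄, d₆, d₇, d₈` (`flow_g4` to `flow_g8`).
--
-- Locality. A counterterm `ψ` makes `ψ ⋆ φˢ` holomorphic for every `s`. Differentiating at `s = 0`
-- brings down `λ` times the degree, so the degree-weighted terms of `ψ ⋆ φ` have together at most a
-- simple pole. For the logarithm this says that `x, y, z` and `3w - xy` have at most simple poles.
-- Comparing `χ_t` with `φ` on `t₆` forces `4 d₆ - d₄ x` to have at most a simple pole
-- (`IsCounterterm.sub_mem_of_isCounterterm`). Conversely this condition and its analogues for `t₇,
-- t₈` suffice, through an explicit counterterm (`IsCounterterm.isLocal_of_sub_mem`).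
--
-- The obstruction. The bracket `x R y - R x y = 2 (x₋ y₊ - x₊ y₋)` does not raise pole orders, so
-- the terms in `z` and in `t²` drop out. Modulo simple poles the conditions for `t₆, t₇, t₈` become
-- `t`, `-t`, `-3t` times the same series `8 w x₊ + C x` (`isLocal_flow_iff`). Substituting `3w ≡
-- xy`, three times that series is `4 x₋ (3 x₋ y₊ - y₋ x₊)` (`laxObstruction_mem_iff`), and its
-- `λ⁻²` coefficient decides. Finally `f₁, f₂` are primitive, so `x₋ = -φ₋(f₁)`, `x₊ = φ₊(f₁)`, and
-- likewise for `y` and `f₂`.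

namespace TreeHopf

-- Laurent series: coefficients and the filtration by pole order.

namespace Laurent

theorem ext {x y : Laurent} (h : ∀ k, x.coeff k = y.coeff k) : x = y :=
  HahnSeries.ext (funext h)

@[simp] theorem coeff_zero (k : ℤ) : (0 : Laurent).coeff k = 0 := rfl
@[simp] theorem coeff_add (x y : Laurent) (k : ℤ) : (x + y).coeff k = x.coeff k + y.coeff k := rfl
@[simp] theorem coeff_neg (x : Laurent) (k : ℤ) : (-x).coeff k = -x.coeff k := rfl
@[simp] theorem coeff_sub (x y : Laurent) (k : ℤ) : (x - y).coeff k = x.coeff k - y.coeff k := rfl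
@[simp] theorem coeff_smul (c : ℂ) (x : Laurent) (k : ℤ) : (c • x).coeff k = c * x.coeff k := rfl

theorem coeff_single_mul (x : Laurent) (b : ℤ) (c : ℂ) (k : ℤ) :
    (single b c * x).coeff k = c * x.coeff (k - b) := by
  have h := HahnSeries.coeff_single_mul_add (r := c) (x := (x : LaurentSeries ℂ)) (a := k - b)
    (b := b)
  rw [sub_add_cancel] at h
  exact h

theorem single_zero_one : single 0 1 = 1 := rfl

theorem single_zero (c : ℂ) : single 0 c = c • (1 : Laurent) := by
  refine ext fun k => ?_
  rw [coeff_smul]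
  by_cases h : k = 0
  · subst h
    exact (HahnSeries.coeff_single_same _ _).trans
      ((congrArg (c * ·) (HahnSeries.coeff_single_same (0 : ℤ) (1 : ℂ))).trans (mul_one c)).symm
  · exact (HahnSeries.coeff_single_of_ne h).trans
      ((congrArg (c * ·) (HahnSeries.coeff_single_of_ne h)).trans (mul_zero c)).symm

/-- A power series in `λ`, seen as a Laurent series. -/
noncomputable def ofPower : PowerSeries ℂ →+* Laurent := HahnSeries.ofPowerSeries ℤ ℂ

theorem coeff_ofPower (f : PowerSeries ℂ) (k : ℤ) :
    (ofPower f).coeff k = if k < 0 then 0 else PowerSeries.coeff k.natAbs f :=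
  PowerSeries.coeff_coe f k

theorem ofPower_C (c : ℂ) : ofPower (PowerSeries.C c) = single 0 c := by
  exact HahnSeries.ofPowerSeries_C c

end Laurent

open Laurent

/-- The Laurent series whose pole at `0` has order at most `n`. -/
def poleLE (n : ℤ) : Submodule ℂ Laurent where
  carrier := {x | ∀ k : ℤ, k < -n → x.coeff k = 0}
  add_mem' hx hy k hk := by simp [hx k hk, hy k hk]
  zero_mem' := by simp
  smul_mem' c x hx k hk := by simp [hx k hk]

theorem mem_poleLE {n : ℤ} {x : Laurent} : x ∈ poleLE n ↔ ∀ k : ℤ, k < -n → x.coeff k = 0 :=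
  Iff.rfl

theorem poleLE_mono {m n : ℤ} (h : m ≤ n) : poleLE m ≤ poleLE n :=
  fun _ hx k hk => hx k (by omega)

theorem exists_mem_poleLE (x : Laurent) : ∃ n, x ∈ poleLE n :=
  ⟨-HahnSeries.order (x : LaurentSeries ℂ), fun k hk => by
    rw [neg_neg] at hk
    exact HahnSeries.coeff_eq_zero_of_lt_order hk⟩

/-- Factoring out a power of `λ` turns products of Laurent series into products of power series;
both the pole order and the extreme coefficient of a product are read off this way. -/
theorem exists_eq_single_mul {n : ℤ} {x : Laurent} (hx : x ∈ poleLE n) :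
    ∃ f, x = single (-n) 1 * ofPower f := by
  refine ⟨PowerSeries.mk fun i => x.coeff (i - n), ext fun k => ?_⟩
  rw [coeff_single_mul, coeff_ofPower, one_mul, sub_neg_eq_add]
  split_ifs with h
  · exact hx k (by omega)
  · rw [PowerSeries.coeff_mk]
    congr 1
    omega

theorem coeff_single_mul_ofPower (n : ℤ) (f : PowerSeries ℂ) (k : ℤ) :
    (single (-n) 1 * ofPower f).coeff k
      = if k < -n then 0 else PowerSeries.coeff (k + n).natAbs f := by
  rw [coeff_single_mul, coeff_ofPower, one_mul, sub_neg_eq_add]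
  simp only [show k + n < 0 ↔ k < -n by omega]

theorem single_mul_ofPower_mem (n : ℤ) (f : PowerSeries ℂ) :
    single (-n) 1 * ofPower f ∈ poleLE n := fun k hk => by
  rw [coeff_single_mul_ofPower, if_pos hk]

theorem single_mul_single (a b : ℤ) (c d : ℂ) :
    single a c * single b d = single (a + b) (c * d) :=
  HahnSeries.single_mul_single

theorem single_mul_mul_single_mul (m n : ℤ) (f g : PowerSeries ℂ) :
    (single (-m) 1 * ofPower f) * (single (-n) 1 * ofPower g)
      = single (-(m + n)) 1 * ofPower (f * g) := by
  rw [mul_mul_mul_comm, single_mul_single, map_mul, one_mul, neg_add]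

theorem mul_mem_poleLE {m n : ℤ} {x y : Laurent} (hx : x ∈ poleLE m) (hy : y ∈ poleLE n) :
    x * y ∈ poleLE (m + n) := by
  obtain ⟨f, rfl⟩ := exists_eq_single_mul hx
  obtain ⟨g, rfl⟩ := exists_eq_single_mul hy
  rw [single_mul_mul_single_mul]
  exact single_mul_ofPower_mem _ _

theorem mul_mem_poleLE_of_eq {m n l : ℤ} {x y : Laurent} (hx : x ∈ poleLE m) (hy : y ∈ poleLE n)
    (h : m + n = l) : x * y ∈ poleLE l := h ▸ mul_mem_poleLE hx hy

theorem coeff_mul_of_mem {m n : ℤ} {x y : Laurent} (hx : x ∈ poleLE m) (hy : y ∈ poleLE n) :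
    (x * y).coeff (-(m + n)) = x.coeff (-m) * y.coeff (-n) := by
  obtain ⟨f, rfl⟩ := exists_eq_single_mul hx
  obtain ⟨g, rfl⟩ := exists_eq_single_mul hy
  rw [single_mul_mul_single_mul]
  simp only [coeff_single_mul_ofPower]
  simp

theorem mem_poleLE_of_coeff_eq_zero {n : ℤ} {x : Laurent} (hx : x ∈ poleLE (n + 1))
    (h : x.coeff (-(n + 1)) = 0) : x ∈ poleLE n := fun k hk => by
  rcases eq_or_ne k (-(n + 1)) with rfl | h'
  · exact h
  · exact hx k (by omega)

/-! ### Polar and holomorphic parts -/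

theorem coeff_polarPart (x : Laurent) (k : ℤ) :
    (polarPart x).coeff k = if k < 0 then x.coeff k else 0 := rfl

theorem coeff_holPart (x : Laurent) (k : ℤ) :
    (holPart x).coeff k = if k < 0 then 0 else x.coeff k := by
  have : (holPart x).coeff k = x.coeff k - (polarPart x).coeff k := rfl
  rw [this, coeff_polarPart]
  split_ifs <;> simp

theorem polarPart_add_holPart (x : Laurent) : polarPart x + holPart x = x := by
  simp [holPart]

theorem holPart_mem (x : Laurent) : holPart x ∈ poleLE 0 := fun k hk => by
  rw [coeff_holPart, if_pos (by simpa using hk)]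

theorem polarPart_mem {n : ℤ} {x : Laurent} (hx : x ∈ poleLE n) : polarPart x ∈ poleLE n :=
  fun k hk => by rw [coeff_polarPart, hx k hk, ite_self]

/-- The space `λ⁻¹ ℂ[λ⁻¹]` of polar Laurent series. -/
def polar : Submodule ℂ Laurent where
  carrier := {x | ∀ k : ℤ, 0 ≤ k → x.coeff k = 0}
  add_mem' hx hy k hk := by simp [hx k hk, hy k hk]
  zero_mem' := by simp
  smul_mem' c x hx k hk := by simp [hx k hk]

theorem polarPart_mem_polar (x : Laurent) : polarPart x ∈ polar := fun k hk => by
  rw [coeff_polarPart, if_neg (by omega)]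

/-- If two exponents add up to `k ≥ 0`, one of them is nonnegative. This closure makes it enough to
check the polarity of a counterterm on generators. -/
theorem mul_mem_polar {x y : Laurent} (hx : x ∈ polar) (hy : y ∈ polar) : x * y ∈ polar :=
  fun k hk => by
    refine HahnSeries.coeff_mul.trans (Finset.sum_eq_zero fun ij hij => ?_)
    have h := (Finset.mem_antidiagonal.1 hij).2.2
    rcases lt_or_ge ij.1 0 with h1 | h1
    · exact mul_eq_zero_of_right _ (hy _ (by omega))
    · exact mul_eq_zero_of_left (hx _ h1) _

theorem eq_zero_of_mem_polar {x : Laurent} (hx : x ∈ polar) (hx' : x ∈ poleLE 0) : x = 0 :=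
  ext fun k => by
    rcases lt_or_ge k 0 with h | h
    · exact hx' k (by simpa using h)
    · exact hx k h

theorem polarPart_eq {x a b : Laurent} (h : x = a + b) (ha : a ∈ polar) (hb : b ∈ poleLE 0) :
    polarPart x = a := by
  subst h
  refine ext fun k => ?_
  rw [coeff_polarPart]
  split_ifs with hk
  · rw [coeff_add, hb k (by simpa using hk), add_zero]
  · exact (ha k (by omega)).symm

theorem holPart_eq {x a b : Laurent} (h : x = a + b) (ha : a ∈ polar) (hb : b ∈ poleLE 0) :
    holPart x = b := by
  have := polarPart_add_holPart x
  rw [polarPart_eq h ha hb] at this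
  exact add_left_cancel (this.trans h)

/-! ### Exponential series -/

theorem expSeries_eq (c : ℂ) :
    expSeries c = ofPower (PowerSeries.rescale c (PowerSeries.exp ℂ)) := rfl

theorem coeff_rescale_exp (c : ℂ) (n : ℕ) :
    PowerSeries.coeff n (PowerSeries.rescale c (PowerSeries.exp ℂ)) = c ^ n / n.factorial := by
  simp [PowerSeries.coeff_exp, div_eq_mul_inv]

theorem ofPower_X : ofPower PowerSeries.X = single 1 1 :=
  HahnSeries.ofPowerSeries_X

/-- Second order in `λ` is enough: the differences to be rescaled have at most double poles, so the
remainder contributes only holomorphic terms. -/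
theorem expSeries_sub_one_sub_mem (c : ℂ) :
    expSeries c - 1 - single 1 c ∈ poleLE (-2) := by
  have h : expSeries c - 1 - single 1 c = ofPower
      (PowerSeries.rescale c (PowerSeries.exp ℂ) - 1 - PowerSeries.C c * PowerSeries.X) := by
    rw [map_sub, map_sub, map_mul, map_one, ← expSeries_eq, ofPower_C, ofPower_X,
      single_mul_single]
    simp
  intro k hk
  rw [h, coeff_ofPower]
  split_ifs with h0
  · rfl
  · obtain ⟨n, rfl⟩ := Int.eq_ofNat_of_zero_le (not_lt.1 h0)
    have : n = 0 ∨ n = 1 := by omega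
    rcases this with rfl | rfl
    · simp only [map_sub, Int.natAbs_natCast, coeff_rescale_exp]
      simp
    · simp [PowerSeries.coeff_one]

theorem single_mem_poleLE (k : ℤ) (c : ℂ) : single k c ∈ poleLE (-k) := fun _ hj =>
  HahnSeries.coeff_single_of_ne (by omega)

theorem expSeries_sub_one_mem (c : ℂ) : expSeries c - 1 ∈ poleLE (-1) := by
  have := add_mem (poleLE_mono (by norm_num) (expSeries_sub_one_sub_mem c))
    (single_mem_poleLE 1 c)
  simpa using this

theorem one_mem_poleLE : (1 : Laurent) ∈ poleLE 0 := by
  simpa [single_zero_one] using single_mem_poleLE 0 1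

theorem expSeries_mul_sub_mem {x : Laurent} (hx : x ∈ poleLE 1) (c : ℂ) :
    expSeries c * x - x ∈ poleLE 0 := by
  have := mul_mem_poleLE (expSeries_sub_one_mem c) hx
  rwa [sub_mul, one_mul] at this

theorem expSeries_mul_sub_sub_mem {x : Laurent} (hx : x ∈ poleLE 2) (c : ℂ) :
    expSeries c * x - x - c • (single 1 1 * x) ∈ poleLE 0 := by
  have := mul_mem_poleLE (expSeries_sub_one_sub_mem c) hx
  have e : single 1 c = c • single 1 1 := by
    rw [← mul_one c, ← zero_add (1 : ℤ), ← single_mul_single, Laurent.single_zero]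
    simp
  rwa [sub_mul, sub_mul, one_mul, e, smul_mul_assoc] at this

theorem single_one_mul_mem_iff {x : Laurent} : single 1 1 * x ∈ poleLE 0 ↔ x ∈ poleLE 1 := by
  simp only [mem_poleLE, coeff_single_mul, one_mul]
  exact ⟨fun h k hk => by simpa using h (k + 1) (by omega), fun h k hk => h _ (by omega)⟩

theorem hasDerivAt_coeff_expSeries (c : ℂ) (x : Laurent) (k : ℤ) :
    HasDerivAt (fun s : ℂ => (expSeries (s * c) * x).coeff k) ((c • (single 1 1 * x)).coeff k) 0 := by
  obtain ⟨n, hn⟩ := exists_mem_poleLE x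
  obtain ⟨f, rfl⟩ := exists_eq_single_mul hn
  simp only [expSeries_eq, mul_left_comm, ← map_mul, ← ofPower_X, coeff_smul,
    coeff_single_mul_ofPower]
  split_ifs with h
  · simpa using hasDerivAt_const _ _
  · generalize (k + n).natAbs = d
    -- At `s = 0` the derivative of `(s c)^i / i!` is `c` for `i = 1` and zero otherwise, so only
    -- the linear term of the exponential survives.
    have e : c * PowerSeries.coeff d (PowerSeries.X * f)
        = ∑ p ∈ Finset.HasAntidiagonal.antidiagonal d,
            (if p.1 = 1 then c else 0) * PowerSeries.coeff p.2 f := by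
      rw [PowerSeries.coeff_mul, Finset.mul_sum]
      refine Finset.sum_congr rfl fun p _ => ?_
      rw [PowerSeries.coeff_X]
      split_ifs <;> simp
    simp only [PowerSeries.coeff_mul d (PowerSeries.rescale _ _), coeff_rescale_exp]
    rw [e]
    refine HasDerivAt.fun_sum fun p _ => HasDerivAt.mul_const ?_ _
    have h1 := (((hasDerivAt_id (0 : ℂ)).mul_const c).pow p.1).div_const (p.1.factorial : ℂ)
    refine h1.congr_deriv ?_
    rcases p with ⟨_ | _ | i, j⟩ <;> simp

/-- The coefficientwise derivative at `0` of a family of Laurent series. -/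
def HasCoeffDeriv (F : ℂ → Laurent) (F' : Laurent) : Prop :=
  ∀ k, HasDerivAt (fun s => (F s).coeff k) (F'.coeff k) 0

namespace HasCoeffDeriv

theorem const (x : Laurent) : HasCoeffDeriv (fun _ => x) 0 := fun _ => hasDerivAt_const _ _

theorem add {F G : ℂ → Laurent} {F' G' : Laurent} (hF : HasCoeffDeriv F F')
    (hG : HasCoeffDeriv G G') : HasCoeffDeriv (fun s => F s + G s) (F' + G') :=
  fun k => (hF k).add (hG k)

theorem exp_mul (c : ℂ) (x y : Laurent) :
    HasCoeffDeriv (fun s => y * (expSeries (s * c) * x)) (single 1 1 * (c • (y * x))) := fun k => by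
  have := hasDerivAt_coeff_expSeries c (y * x) k
  simp only [mul_left_comm y]
  rwa [mul_smul_comm]

/-- Negative coefficients vanish for all `s`, hence so do their derivatives: `λ y` is holomorphic.
This is how locality yields bounds on poles. -/
theorem mem {F : ℂ → Laurent} {y : Laurent} (h : HasCoeffDeriv F (single 1 1 * y))
    (hF : ∀ s, F s ∈ poleLE 0) : y ∈ poleLE 1 := by
  rw [← single_one_mul_mem_iff]
  intro k hk
  refine (h k).unique ?_
  simp only [hF _ k hk]
  exact hasDerivAt_const _ _

end HasCoeffDeriv

end TreeHopf

namespace TreeHopf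

/-! ### The exponential of the logarithm -/

section ExpLog

open Polynomial

/-- The truncated exponential series. -/
noncomputable def expPoly (n : ℕ) : ℂ[X] :=
  ∑ k ∈ Finset.range n, C ((k.factorial : ℂ)⁻¹) * X ^ k

/-- The truncated series of `log (1 + X)`. -/
noncomputable def logPoly (n : ℕ) : ℂ[X] :=
  ∑ k ∈ Finset.Ico 1 n, C ((-1 : ℂ) ^ (k - 1) / (k : ℂ)) * X ^ k

theorem derivative_expPoly_succ (n : ℕ) : derivative (expPoly (n + 1)) = expPoly n := by
  rw [expPoly, Finset.sum_range_succ', derivative_add, derivative_sum]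
  simp only [pow_zero, mul_one, derivative_C, add_zero, expPoly]
  refine Finset.sum_congr rfl fun k _ => ?_
  rw [derivative_C_mul_X_pow]
  congr 2
  rw [Nat.factorial_succ]
  have := Nat.cast_add_one_ne_zero (R := ℂ) k
  push_cast
  field_simp

theorem logPoly_succ (n : ℕ) :
    logPoly (n + 2) = logPoly (n + 1) + C ((-1 : ℂ) ^ n / ((n + 1 : ℕ) : ℂ)) * X ^ (n + 1) := by
  rw [logPoly, Finset.sum_Ico_succ_top (by omega)]
  rfl

/-- The derivative is a truncated geometric series for `1 / (1 + X)`, and the sum telescopes. -/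
theorem one_add_X_mul_derivative_logPoly (n : ℕ) :
    (1 + X) * derivative (logPoly (n + 1)) = 1 - (-X) ^ n := by
  induction n with
  | zero => simp [logPoly]
  | succ n ih =>
    rw [logPoly_succ, derivative_add, mul_add, ih, derivative_C_mul_X_pow,
      div_mul_cancel₀ _ (Nat.cast_ne_zero.2 n.succ_ne_zero)]
    simp only [map_pow, map_neg, map_one, Nat.add_sub_cancel]
    rw [neg_pow (X : ℂ[X]) n, neg_pow (X : ℂ[X]) (n + 1)]
    ring

theorem X_dvd_logPoly (n : ℕ) : X ∣ logPoly n :=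
  Finset.dvd_sum fun k hk =>
    Dvd.dvd.mul_left (dvd_pow_self _ (by have := Finset.mem_Ico.1 hk; omega)) _

/-- Once the coefficients of `D` up to degree `d` vanish, the coefficient of degree `d` in the
equation reads `(d + 1) D_{d+1} = 0`. -/
theorem X_pow_dvd_of_ode {m : ℕ} {D : ℂ[X]} (h0 : D.coeff 0 = 0)
    (h : X ^ m ∣ (1 + X) * derivative D - D) : X ^ (m + 1) ∣ D := by
  rw [X_pow_dvd_iff] at h ⊢
  intro d
  induction d with
  | zero => exact fun _ => h0
  | succ d ih =>
    intro hd
    have hd' := ih (by omega)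
    have := h d (by omega)
    rw [coeff_sub, add_mul, one_mul, coeff_add, coeff_derivative, hd'] at this
    have e : (X * derivative D).coeff d = 0 := by
      cases d with
      | zero => simp
      | succ d => rw [coeff_X_mul, coeff_derivative, hd', zero_mul]
    rw [e, add_zero, sub_zero] at this
    exact (mul_eq_zero.1 this).resolve_right (Nat.cast_add_one_ne_zero d)

/-- Both `exp (log (1 + X))` and `1 + X` solve `(1 + X) F' = F` with `F(0) = 1`. For the truncations
the equation fails only by multiples of `X^N` and of `log^(M+1)`, both divisible by `X^m`. -/
theorem X_pow_dvd_expPoly_comp_logPoly (m : ℕ) {M N : ℕ} (hM : m ≤ M) (hN : m ≤ N) :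
    X ^ (m + 1) ∣ (expPoly (M + 2)).comp (logPoly (N + 1)) - (1 + X) := by
  apply X_pow_dvd_of_ode
  · obtain ⟨q, hq⟩ := X_dvd_logPoly (N + 1)
    have h0 : (logPoly (N + 1)).eval 0 = 0 := by simp [hq]
    rw [coeff_zero_eq_eval_zero, eval_sub, eval_comp, h0, expPoly, Finset.sum_range_succ']
    simp [eval_finsetSum]
  · have e : (expPoly (M + 2)).comp (logPoly (N + 1)) = (expPoly (M + 1)).comp (logPoly (N + 1))
        + C (((M + 1).factorial : ℂ)⁻¹) * logPoly (N + 1) ^ (M + 1) := by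
      conv_lhs => rw [expPoly, Finset.sum_range_succ, ← expPoly]
      simp
    have h : (1 + X) * derivative ((expPoly (M + 2)).comp (logPoly (N + 1)) - (1 + X))
          - ((expPoly (M + 2)).comp (logPoly (N + 1)) - (1 + X))
        = -((-X) ^ N * (expPoly (M + 1)).comp (logPoly (N + 1)))
          - C (((M + 1).factorial : ℂ)⁻¹) * logPoly (N + 1) ^ (M + 1) := by
      rw [derivative_sub, derivative_comp, derivative_expPoly_succ, mul_sub, ← mul_assoc,
        one_add_X_mul_derivative_logPoly, e]
      simp only [derivative_add, derivative_one, derivative_X]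
      ring
    rw [h]
    refine dvd_sub ((Dvd.dvd.mul_right ?_ _).neg_right) (Dvd.dvd.mul_left ?_ _)
    · rw [neg_pow]
      exact Dvd.dvd.mul_left (pow_dvd_pow _ hN) _
    · exact (pow_dvd_pow _ (by omega)).trans (pow_dvd_pow_of_dvd (X_dvd_logPoly _) _)

end ExpLog

-- Functionals under convolution, and `exp (log φ) = φ`.

section Convolution

variable {K : Type} [CommRing K] [Bialgebra ℂ K]

theorem conv_ext {A B : WithConv (K →ₗ[ℂ] Laurent)} (h : ∀ x, A x = B x) : A = B :=
  WithConv.ofConv_injective (LinearMap.ext h)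

@[simp] theorem conv_add_apply (A B : WithConv (K →ₗ[ℂ] Laurent)) (x : K) :
    (A + B) x = A x + B x := rfl

@[simp] theorem conv_sub_apply (A B : WithConv (K →ₗ[ℂ] Laurent)) (x : K) :
    (A - B) x = A x - B x := rfl

@[simp] theorem conv_smul_apply (c : ℂ) (A : WithConv (K →ₗ[ℂ] Laurent)) (x : K) :
    (c • A) x = c • A x := rfl

theorem conv_sum_apply {ι : Type*} (s : Finset ι) (A : ι → WithConv (K →ₗ[ℂ] Laurent)) (x : K) :
    (∑ i ∈ s, A i) x = ∑ i ∈ s, A i x := by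
  classical
  induction s using Finset.induction_on with
  | empty => rfl
  | insert a s ha ih => rw [Finset.sum_insert ha, Finset.sum_insert ha, conv_add_apply, ih]

open Filter

/-- The coproduct of one element is a finite sum of tensors, so only finitely many stabilization
conditions are needed at a time. -/
theorem eventually_conv_mul {A B : ℕ → WithConv (K →ₗ[ℂ] Laurent)}
    {A' B' : WithConv (K →ₗ[ℂ] Laurent)} (hA : ∀ x, ∀ᶠ n in atTop, A n x = A' x)
    (hB : ∀ x, ∀ᶠ n in atTop, B n x = B' x) (x : K) :
    ∀ᶠ n in atTop, (A n * B n) x = (A' * B') x := by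
  have h : ∀ z : K ⊗[ℂ] K, ∀ᶠ n in atTop,
      LinearMap.mul' ℂ Laurent (TensorProduct.map (A n).ofConv (B n).ofConv z)
        = LinearMap.mul' ℂ Laurent (TensorProduct.map A'.ofConv B'.ofConv z) := by
    intro z
    induction z with
    | zero => simp
    | add u v hu hv =>
      filter_upwards [hu, hv] with n h1 h2
      simp only [map_add, h1, h2]
    | tmul u v =>
      filter_upwards [hA u, hB v] with n h1 h2
      simp only [TensorProduct.map_tmul, LinearMap.mul'_apply]
      exact congrArg₂ _ h1 h2
  filter_upwards [h (Coalgebra.comul x)] with n hn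
  rw [LinearMap.convMul_apply, LinearMap.convMul_apply]
  exact hn

theorem eventually_conv_pow {A : ℕ → WithConv (K →ₗ[ℂ] Laurent)}
    {A' : WithConv (K →ₗ[ℂ] Laurent)} (hA : ∀ x, ∀ᶠ n in atTop, A n x = A' x) (k : ℕ) (x : K) :
    ∀ᶠ n in atTop, (A n ^ k) x = (A' ^ k) x := by
  induction k generalizing x with
  | zero => simp
  | succ k ih =>
    simp only [pow_succ]
    exact eventually_conv_mul ih hA x

theorem aeval_expPoly_apply (Z : WithConv (K →ₗ[ℂ] Laurent)) (n : ℕ) (x : K) :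
    (Polynomial.aeval Z (expPoly n)) x
      = ∑ k ∈ Finset.range n, ((k.factorial : ℂ)⁻¹) • (Z ^ k) x := by
  rw [expPoly, map_sum, conv_sum_apply]
  refine Finset.sum_congr rfl fun k _ => ?_
  rw [← Polynomial.smul_eq_C_mul, map_smul, map_pow, Polynomial.aeval_X, conv_smul_apply]

theorem aeval_logPoly_apply (J : WithConv (K →ₗ[ℂ] Laurent)) (n : ℕ) (x : K) :
    (Polynomial.aeval J (logPoly n)) x
      = ∑ k ∈ Finset.Ico 1 n, ((-1 : ℂ) ^ (k - 1) / (k : ℂ)) • (J ^ k) x := by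
  rw [logPoly, map_sum, conv_sum_apply]
  refine Finset.sum_congr rfl fun k _ => ?_
  rw [← Polynomial.smul_eq_C_mul, map_smul, map_pow, Polynomial.aeval_X, conv_smul_apply]

theorem aeval_apply_eq_zero {J : WithConv (K →ₗ[ℂ] Laurent)} {x : K} {m : ℕ}
    (hJ : ∀ k, m ≤ k → (J ^ k) x = 0) {p : Polynomial ℂ} (hp : Polynomial.X ^ m ∣ p) :
    (Polynomial.aeval J p) x = 0 := by
  rw [Polynomial.aeval_eq_sum_range, conv_sum_apply]
  refine Finset.sum_eq_zero fun k _ => ?_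
  rw [conv_smul_apply]
  rcases lt_or_ge k m with h | h
  · rw [Polynomial.X_pow_dvd_iff.1 hp k h, zero_smul]
  · rw [hJ k h, smul_zero]

/-- The polynomial congruence for `exp ∘ log` is evaluated at `J = φ - ε`, whose high powers vanish
on the given element. -/
theorem eq_of_isLog_of_isExp {φ χ : K →ₐ[ℂ] Laurent} {Z : WithConv (K →ₗ[ℂ] Laurent)}
    (hlog : IsLog φ Z) (hexp : IsExp Z χ) : χ = φ := by
  refine AlgHom.ext fun x => ?_
  set J : WithConv (K →ₗ[ℂ] Laurent) := WithConv.toConv φ.toLinearMap - 1 with hJ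
  have hlog' : ∀ y, ∀ᶠ n in atTop, (Polynomial.aeval J (logPoly n)) y = Z y := fun y => by
    simp only [aeval_logPoly_apply]
    exact hlog y
  -- Local nilpotency of `J` comes from the convergence itself: consecutive partial sums of the
  -- logarithm differ by a nonzero multiple of `J^k x`.
  obtain ⟨m, hm⟩ : ∃ m, ∀ k, m ≤ k → (J ^ k) x = 0 := by
    obtain ⟨m, hm⟩ := eventually_atTop.1 (hlog x)
    refine ⟨m + 1, fun k hk => ?_⟩
    have h1 := hm k (by omega)
    have h2 := hm (k + 1) (by omega)
    rw [Finset.sum_Ico_succ_top (by omega), h1, add_eq_left, smul_eq_zero] at h2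
    refine h2.resolve_left (div_ne_zero (pow_ne_zero _ (by norm_num)) (Nat.cast_ne_zero.2 ?_))
    omega
  have hexp' := (eventually_atTop.1 (hexp x))
  obtain ⟨M, hM⟩ := hexp'
  -- Both truncation orders are taken beyond stabilization and beyond `m`, so that the congruence
  -- modulo `X^(m+1)` applies.
  have h1 := hM (max M m + 2) (by omega)
  have h2 : ∀ᶠ n in atTop, (Polynomial.aeval (Polynomial.aeval J (logPoly n))
      (expPoly (max M m + 2))) x = χ x := by
    rw [← h1]
    simp only [aeval_expPoly_apply]
    have : ∀ᶠ n in atTop, ∀ k ∈ Finset.range (max M m + 2),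
        ((Polynomial.aeval J (logPoly n)) ^ k) x = (Z ^ k) x :=
      (Filter.eventually_all_finset _).2 fun k _ => eventually_conv_pow hlog' k x
    filter_upwards [this] with n hn
    exact Finset.sum_congr rfl fun k hk => by rw [hn k hk]
  obtain ⟨N, hN⟩ := eventually_atTop.1 h2
  have h3 := hN (max N m + 1) (by omega)
  rw [← Polynomial.aeval_comp] at h3
  have h4 := aeval_apply_eq_zero hm ((pow_dvd_pow _ (Nat.le_succ m)).trans
    (X_pow_dvd_expPoly_comp_logPoly m (le_max_right M m) (le_max_right N m)))
  rw [map_sub, conv_sub_apply, h3, map_add, map_one, Polynomial.aeval_X, hJ,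
    add_sub_cancel] at h4
  exact sub_eq_zero.1 h4

end Convolution

/-! ### The coproduct of `H³` on the generators -/

section Generators

variable {N : Set ℕ}

theorem inclTensor_comul (x : H3 N) :
    inclTensor (generators N) (Coalgebra.comul (R := ℂ) x) = coproduct (x : TreeAlg) :=
  DFunLike.congr_fun (inclTensor_comp_subCoproduct (cutClosed_generators N)) x

theorem counit_treeGen (t : generators N) :
    Coalgebra.counit (R := ℂ) (treeGen (generators N) t) = 0 := by
  have : Coalgebra.counit (R := ℂ) (treeGen (generators N) t)
      = counitHom (MvPolynomial.X t.1) := rfl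
  rw [this, counitHom, MvPolynomial.aeval_X]

variable (N)

noncomputable def g1 : H3 N := treeGen (generators N) ⟨t1, by simp [generators]⟩
noncomputable def g2 : H3 N := treeGen (generators N) ⟨t2, by simp [generators]⟩
noncomputable def g3 : H3 N := treeGen (generators N) ⟨t3, by simp [generators]⟩
noncomputable def g4 : H3 N := treeGen (generators N) ⟨t4, by simp [generators]⟩
noncomputable def g6 : H3 N := treeGen (generators N) ⟨t6, by simp [generators]⟩
noncomputable def g7 : H3 N := treeGen (generators N) ⟨t7, by simp [generators]⟩
noncomputable def g8 : H3 N := treeGen (generators N) ⟨t8, by simp [generators]⟩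

/-- The ladders among the generators: all those of index at most `n`, for `n ∈ N`. -/
noncomputable def gLadder {n : ℕ} (hn : n ∈ N) (k : Fin (n + 1)) : H3 N :=
  treeGen (generators N) ⟨ladder k, Or.inr ⟨n, hn, k, Fin.is_le k, rfl⟩⟩

variable {N}

theorem coe_g1 : (g1 N : TreeAlg) = MvPolynomial.X t1 := rfl
theorem coe_g2 : (g2 N : TreeAlg) = MvPolynomial.X t2 := rfl
theorem coe_g3 : (g3 N : TreeAlg) = MvPolynomial.X t3 := rfl
theorem coe_g4 : (g4 N : TreeAlg) = MvPolynomial.X t4 := rfl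
theorem coe_g6 : (g6 N : TreeAlg) = MvPolynomial.X t6 := rfl
theorem coe_g7 : (g7 N : TreeAlg) = MvPolynomial.X t7 := rfl
theorem coe_g8 : (g8 N : TreeAlg) = MvPolynomial.X t8 := rfl

/-- By injectivity of `H³ ⊗ H³ → H ⊗ H`, the coproduct of `H³`, defined by a choice of preimages, is
identified with the explicit formulas in the full algebra. -/
theorem comul_eq_of_inclTensor {x : H3 N} {z : H3 N ⊗[ℂ] H3 N}
    (h : coproduct (x : TreeAlg) = inclTensor (generators N) z) :
    Coalgebra.comul (R := ℂ) x = z :=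
  inclTensor_injective _ ((inclTensor_comul x).trans h)

theorem inclTensor_tmul (x y : H3 N) :
    inclTensor (generators N) (x ⊗ₜ y) = (x : TreeAlg) ⊗ₜ[ℂ] (y : TreeAlg) := rfl

variable (A B : WithConv (H3 N →ₗ[ℂ] Laurent))

theorem conv_mul_apply_of_comul {x : H3 N} {z : H3 N ⊗[ℂ] H3 N}
    (h : coproduct (x : TreeAlg) = inclTensor (generators N) z) :
    (A * B) x = LinearMap.mul' ℂ Laurent (TensorProduct.map A.ofConv B.ofConv z) := by
  rw [LinearMap.convMul_apply, comul_eq_of_inclTensor h]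

theorem mul'_map_tmul (x y : H3 N) :
    LinearMap.mul' ℂ Laurent (TensorProduct.map A.ofConv B.ofConv (x ⊗ₜ y)) = A x * B y := rfl

theorem conv_mul_one : (A * B) (1 : H3 N) = A 1 * B 1 := by
  rw [conv_mul_apply_of_comul A B (z := 1 ⊗ₜ 1) (by
    simp only [inclTensor_tmul, OneMemClass.coe_one, map_one, Algebra.TensorProduct.one_def]),
    mul'_map_tmul]

theorem conv_mul_g1 : (A * B) (g1 N) = A (g1 N) * B 1 + A 1 * B (g1 N) := by
  rw [conv_mul_apply_of_comul A B (z := g1 N ⊗ₜ 1 + 1 ⊗ₜ g1 N)]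
  · simp only [map_add, mul'_map_tmul]
  · rw [coe_g1, coproduct_t1]
    simp only [map_add, inclTensor_tmul, coe_g1, OneMemClass.coe_one]

theorem conv_mul_g2 : (A * B) (g2 N)
    = A (g2 N) * B 1 + A (g1 N) * B (g1 N) + A 1 * B (g2 N) := by
  rw [conv_mul_apply_of_comul A B (z := g2 N ⊗ₜ 1 + g1 N ⊗ₜ g1 N + 1 ⊗ₜ g2 N)]
  · simp only [map_add, mul'_map_tmul]
  · rw [coe_g2, coproduct_t2]
    simp only [map_add, inclTensor_tmul, coe_g1, coe_g2, OneMemClass.coe_one]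

theorem conv_mul_g3 : (A * B) (g3 N)
    = A (g3 N) * B 1 + A (g2 N) * B (g1 N) + A (g1 N) * B (g2 N) + A 1 * B (g3 N) := by
  rw [conv_mul_apply_of_comul A B
    (z := g3 N ⊗ₜ 1 + g2 N ⊗ₜ g1 N + g1 N ⊗ₜ g2 N + 1 ⊗ₜ g3 N)]
  · simp only [map_add, mul'_map_tmul]
  · rw [coe_g3, coproduct_t3]
    simp only [map_add, inclTensor_tmul, coe_g1, coe_g2, coe_g3, OneMemClass.coe_one]

theorem conv_mul_g4 : (A * B) (g4 N)
    = A (g4 N) * B 1 + A (g1 N * g1 N) * B (g1 N) + 2 * (A (g1 N) * B (g2 N))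
      + A 1 * B (g4 N) := by
  rw [conv_mul_apply_of_comul A B (z := g4 N ⊗ₜ 1 + (g1 N * g1 N) ⊗ₜ g1 N
    + (2 : ℂ) • g1 N ⊗ₜ g2 N + 1 ⊗ₜ g4 N)]
  · simp only [map_add, map_smul, mul'_map_tmul]
    algebra
  · rw [coe_g4, coproduct_t4]
    simp only [map_add, map_smul, inclTensor_tmul, coe_g1, coe_g2, coe_g4, OneMemClass.coe_one,
      MulMemClass.coe_mul]

theorem conv_mul_g6 : (A * B) (g6 N)
    = A (g6 N) * B 1 + A (g4 N) * B (g1 N) + A (g1 N * g1 N) * B (g2 N)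
      + 2 * (A (g1 N) * B (g3 N)) + A 1 * B (g6 N) := by
  rw [conv_mul_apply_of_comul A B (z := g6 N ⊗ₜ 1 + g4 N ⊗ₜ g1 N + (g1 N * g1 N) ⊗ₜ g2 N
    + (2 : ℂ) • g1 N ⊗ₜ g3 N + 1 ⊗ₜ g6 N)]
  · simp only [map_add, map_smul, mul'_map_tmul]
    algebra
  · rw [coe_g6, coproduct_t6]
    simp only [map_add, map_smul, inclTensor_tmul, coe_g1, coe_g2, coe_g3, coe_g4, coe_g6,
      OneMemClass.coe_one, MulMemClass.coe_mul]

theorem conv_mul_g7 : (A * B) (g7 N)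
    = A (g7 N) * B 1 + A (g1 N * g2 N) * B (g1 N) + A (g1 N * g1 N) * B (g2 N)
      + A (g2 N) * B (g2 N) + A (g1 N) * B (g3 N) + A (g1 N) * B (g4 N) + A 1 * B (g7 N) := by
  rw [conv_mul_apply_of_comul A B (z := g7 N ⊗ₜ 1 + (g1 N * g2 N) ⊗ₜ g1 N
    + (g1 N * g1 N) ⊗ₜ g2 N + g2 N ⊗ₜ g2 N + g1 N ⊗ₜ g3 N + g1 N ⊗ₜ g4 N + 1 ⊗ₜ g7 N)]
  · simp only [map_add, mul'_map_tmul]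
  · rw [coe_g7, coproduct_t7]
    simp only [map_add, inclTensor_tmul, coe_g1, coe_g2, coe_g3, coe_g4, coe_g7,
      OneMemClass.coe_one, MulMemClass.coe_mul]

theorem conv_mul_g8 : (A * B) (g8 N)
    = A (g8 N) * B 1 + A (g1 N * (g1 N * g1 N)) * B (g1 N) + 3 * (A (g1 N * g1 N) * B (g2 N))
      + 3 * (A (g1 N) * B (g4 N)) + A 1 * B (g8 N) := by
  rw [conv_mul_apply_of_comul A B (z := g8 N ⊗ₜ 1 + (g1 N * (g1 N * g1 N)) ⊗ₜ g1 N
    + (3 : ℂ) • (g1 N * g1 N) ⊗ₜ g2 N + (3 : ℂ) • g1 N ⊗ₜ g4 N + 1 ⊗ₜ g8 N)]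
  · simp only [map_add, map_smul, mul'_map_tmul]
    algebra
  · rw [coe_g8, coproduct_t8]
    simp only [map_add, map_smul, inclTensor_tmul, coe_g1, coe_g2, coe_g4, coe_g8,
      OneMemClass.coe_one, MulMemClass.coe_mul]

theorem coe_gLadder {n : ℕ} (hn : n ∈ N) (k : Fin (n + 1)) :
    (gLadder N hn k : TreeAlg) = MvPolynomial.X (ladder k) := rfl

theorem conv_mul_gLadder {n : ℕ} (hn : n ∈ N) (k : Fin (n + 1)) : (A * B) (gLadder N hn k)
    = A (gLadder N hn k) * B 1 + A 1 * B (gLadder N hn k)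
      + ∑ i : Fin k, A (gLadder N hn ⟨i, by omega⟩)
          * B (gLadder N hn ⟨k - 1 - i, by omega⟩) := by
  rw [conv_mul_apply_of_comul A B (z := gLadder N hn k ⊗ₜ 1 + 1 ⊗ₜ gLadder N hn k
    + ∑ i : Fin k, gLadder N hn ⟨i, by omega⟩ ⊗ₜ gLadder N hn ⟨k - 1 - i, by omega⟩)]
  · simp only [map_add, map_sum, mul'_map_tmul]
  · rw [coe_gLadder, coproduct_ladder, Finset.sum_range]
    simp only [map_add, map_sum, inclTensor_tmul, coe_gLadder, OneMemClass.coe_one]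

/-- A property of elements of `H³` may be checked on the generators. -/
theorem H3_induction {P : H3 N → Prop} (x : H3 N) (hC : ∀ c : ℂ, P (algebraMap ℂ _ c))
    (hgen : ∀ t, P (treeGen (generators N) t)) (hadd : ∀ x y, P x → P y → P (x + y))
    (hmul : ∀ x y, P x → P y → P (x * y)) : P x := by
  obtain ⟨p, rfl⟩ := (MvPolynomial.supportedEquivMvPolynomial (generators N)).symm.surjective x
  induction p using MvPolynomial.induction_on with
  | C c =>
    have := hC c
    rwa [← (MvPolynomial.supportedEquivMvPolynomial (generators N)).symm.commutes c] at this
  | add p q hp hq => rw [map_add]; exact hadd _ _ hp hq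
  | mul_X p t hp =>
    rw [map_mul]
    refine hmul _ _ hp ?_
    have e : (MvPolynomial.supportedEquivMvPolynomial (generators N)).symm (MvPolynomial.X t)
        = treeGen (generators N) t :=
      Subtype.ext (MvPolynomial.supportedEquivMvPolynomial_symm_X (generators N) t)
    rw [e]
    exact hgen t

theorem mem_generators_cases {P : H3 N → Prop} (h1 : P (g1 N)) (h2 : P (g2 N)) (h3 : P (g3 N))
    (h4 : P (g4 N)) (h6 : P (g6 N)) (h7 : P (g7 N)) (h8 : P (g8 N))
    (hl : ∀ n (hn : n ∈ N) k, P (gLadder N hn k)) (t : generators N) :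
    P (treeGen (generators N) t) := by
  obtain ⟨t, ht⟩ := t
  rcases id ht with ht' | ⟨n, hn, k, hk, rfl⟩
  · simp only [Set.mem_insert_iff, Set.mem_singleton_iff] at ht'
    rcases ht' with rfl | rfl | rfl | rfl | rfl | rfl | rfl <;> assumption
  · exact hl n hn ⟨k, by omega⟩

/-! ### Locality on the generators -/

/-- Holomorphic series form a ring and polar series are closed under products, while `ψ` and `ψ ⋆
φˢ` are multiplicative. Hence both Birkhoff conditions spread from the generators to all of `H³`. -/
theorem isLocal_iff {χ : H3 N →ₐ[ℂ] Laurent} :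
    IsLocal χ ↔ ∃ ψ : H3 N →ₐ[ℂ] Laurent, (∀ t, ψ (treeGen (generators N) t) ∈ polar) ∧
      ∀ s t, (WithConv.toConv ψ.toLinearMap * WithConv.toConv (scale s χ).toLinearMap)
        (treeGen (generators N) t) ∈ poleLE 0 := by
  constructor
  · rintro ⟨ψ, h⟩
    refine ⟨ψ, fun t => ?_, fun s t => ?_⟩
    · obtain ⟨_, hB⟩ := h 0
      exact hB.polar _ (counit_treeGen t)
    · obtain ⟨φp, hB⟩ := h s
      have e : (WithConv.toConv ψ.toLinearMap * WithConv.toConv (scale s χ).toLinearMap)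
          (treeGen (generators N) t) = φp (treeGen (generators N) t) :=
        congrArg (fun f : WithConv (H3 N →ₐ[ℂ] Laurent) => f (treeGen (generators N) t)) hB.factor
      rw [e]
      exact fun k hk => hB.holomorphic _ k (by simpa using hk)
  · rintro ⟨ψ, hpol, hhol⟩
    refine ⟨ψ, fun s => ⟨(WithConv.toConv ψ * WithConv.toConv (scale s χ)).ofConv, ?_, ?_, rfl⟩⟩
    · intro x hx
      -- Subtracting the counit gives a condition meaningful for every element, as induction over
      -- sums and products requires; on the augmentation ideal it is the polarity of `ψ x`.
      have key : ψ x - algebraMap ℂ _ (Coalgebra.counit (R := ℂ) x) ∈ polar := by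
        refine H3_induction (P := fun x => ψ x - algebraMap ℂ _ (Coalgebra.counit (R := ℂ) x)
          ∈ polar) x (fun c => ?_) (fun t => ?_) (fun x y hx hy => ?_) (fun x y hx hy => ?_)
        · simp
        · rw [counit_treeGen]
          simpa using hpol t
        · convert add_mem hx hy using 1
          simp only [map_add]
          ring
        · have e : ψ (x * y) - algebraMap ℂ _ (Coalgebra.counit (R := ℂ) (x * y))
              = (ψ x - algebraMap ℂ _ (Coalgebra.counit (R := ℂ) x))
                * (ψ y - algebraMap ℂ _ (Coalgebra.counit (R := ℂ) y))
              + Coalgebra.counit (R := ℂ) x • (ψ y - algebraMap ℂ _ (Coalgebra.counit (R := ℂ) y))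
              + Coalgebra.counit (R := ℂ) y
                • (ψ x - algebraMap ℂ _ (Coalgebra.counit (R := ℂ) x)) := by
            rw [Bialgebra.counit_mul]
            simp only [map_mul, Algebra.smul_def]
            ring
          rw [e]
          exact add_mem (add_mem (mul_mem_polar hx hy) (polar.smul_mem _ hy)) (polar.smul_mem _ hx)
      rw [hx, map_zero, sub_zero] at key
      exact key
    · intro x k hk
      have key : (WithConv.toConv ψ * WithConv.toConv (scale s χ)).ofConv x ∈ poleLE 0 := by
        refine H3_induction (P := fun x => (WithConv.toConv ψ
          * WithConv.toConv (scale s χ)).ofConv x ∈ poleLE 0) x (fun c => ?_) (fun t => ?_)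
          (fun x y hx hy => ?_) (fun x y hx hy => ?_)
        · rw [AlgHom.commutes, Algebra.algebraMap_eq_smul_one]
          exact (poleLE 0).smul_mem _ one_mem_poleLE
        · exact hhol s t
        · rw [map_add]
          exact add_mem hx hy
        · rw [map_mul]
          exact mul_mem_poleLE hx hy
      exact key k (by simpa using hk)

end Generators

/-! ### Exponentials of infinitesimal characters on the generators -/

section Infinitesimal

variable {N : Set ℕ} {Z : WithConv (H3 N →ₗ[ℂ] Laurent)}

theorem counit_g1 : Coalgebra.counit (R := ℂ) (g1 N) = 0 := counit_treeGen _
theorem counit_g2 : Coalgebra.counit (R := ℂ) (g2 N) = 0 := counit_treeGen _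
theorem counit_g3 : Coalgebra.counit (R := ℂ) (g3 N) = 0 := counit_treeGen _
theorem counit_g4 : Coalgebra.counit (R := ℂ) (g4 N) = 0 := counit_treeGen _
theorem counit_g6 : Coalgebra.counit (R := ℂ) (g6 N) = 0 := counit_treeGen _
theorem counit_g7 : Coalgebra.counit (R := ℂ) (g7 N) = 0 := counit_treeGen _
theorem counit_g8 : Coalgebra.counit (R := ℂ) (g8 N) = 0 := counit_treeGen _

-- Convolution with an infinitesimal character; nilpotency of its powers.

namespace IsInfinitesimalCharacter

variable (hZ : IsInfinitesimalCharacter Z)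

include hZ

theorem apply_one : Z (1 : H3 N) = 0 := by
  have := hZ 1 1
  rw [mul_one, Bialgebra.counit_one, one_smul] at this
  exact left_eq_add.1 this

theorem apply_mul {x y : H3 N} (hx : Coalgebra.counit (R := ℂ) x = 0)
    (hy : Coalgebra.counit (R := ℂ) y = 0) : Z (x * y) = 0 := by
  rw [hZ, hx, hy, zero_smul, zero_smul, add_zero]

variable (B : WithConv (H3 N →ₗ[ℂ] Laurent))

theorem mul_apply_one : (Z * B) (1 : H3 N) = 0 := by
  rw [conv_mul_one, hZ.apply_one, zero_mul]

theorem mul_apply_g1 : (Z * B) (g1 N) = Z (g1 N) * B 1 := by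
  rw [conv_mul_g1, hZ.apply_one, zero_mul, add_zero]

theorem mul_apply_g2 : (Z * B) (g2 N) = Z (g2 N) * B 1 + Z (g1 N) * B (g1 N) := by
  rw [conv_mul_g2, hZ.apply_one, zero_mul, add_zero]

theorem mul_apply_g3 : (Z * B) (g3 N)
    = Z (g3 N) * B 1 + Z (g2 N) * B (g1 N) + Z (g1 N) * B (g2 N) := by
  rw [conv_mul_g3, hZ.apply_one, zero_mul, add_zero]

theorem mul_apply_g4 : (Z * B) (g4 N) = Z (g4 N) * B 1 + 2 * (Z (g1 N) * B (g2 N)) := by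
  rw [conv_mul_g4, hZ.apply_one, hZ.apply_mul counit_g1 counit_g1]
  ring

theorem mul_apply_g6 : (Z * B) (g6 N)
    = Z (g6 N) * B 1 + Z (g4 N) * B (g1 N) + 2 * (Z (g1 N) * B (g3 N)) := by
  rw [conv_mul_g6, hZ.apply_one, hZ.apply_mul counit_g1 counit_g1]
  ring

theorem mul_apply_g7 : (Z * B) (g7 N)
    = Z (g7 N) * B 1 + Z (g2 N) * B (g2 N) + Z (g1 N) * B (g3 N) + Z (g1 N) * B (g4 N) := by
  rw [conv_mul_g7, hZ.apply_one, hZ.apply_mul counit_g1 counit_g1,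
    hZ.apply_mul counit_g1 counit_g2]
  ring

theorem mul_apply_g8 : (Z * B) (g8 N) = Z (g8 N) * B 1 + 3 * (Z (g1 N) * B (g4 N)) := by
  have h : Coalgebra.counit (R := ℂ) (g1 N * g1 N) = 0 := by
    rw [Bialgebra.counit_mul, counit_g1,
      mul_zero]
  rw [conv_mul_g8, hZ.apply_one, hZ.apply_mul counit_g1 counit_g1,
    hZ.apply_mul counit_g1 h]
  ring

theorem mul_apply_gLadder {n : ℕ} (hn : n ∈ N) (k : Fin (n + 1)) : (Z * B) (gLadder N hn k)
    = Z (gLadder N hn k) * B 1 + ∑ i : Fin k, Z (gLadder N hn ⟨i, by omega⟩)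
          * B (gLadder N hn ⟨k - 1 - i, by omega⟩) := by
  rw [conv_mul_gLadder, hZ.apply_one, zero_mul, add_zero]

/-- Base of a recursion on degree: each factor `Z` kills `1` and so uses up at least one vertex.
Hence `Z^j` vanishes on generators with fewer than `j` vertices, which bounds the exponential sums
below. -/
theorem pow_apply_one (k : ℕ) : (Z ^ (k + 1)) (1 : H3 N) = 0 := by
  rw [pow_succ', hZ.mul_apply_one]

theorem pow_apply_g1 (k : ℕ) : (Z ^ (k + 2)) (g1 N) = 0 := by
  rw [pow_succ', hZ.mul_apply_g1, hZ.pow_apply_one, mul_zero]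

theorem pow_apply_g2 (k : ℕ) : (Z ^ (k + 3)) (g2 N) = 0 := by
  rw [pow_succ', hZ.mul_apply_g2, hZ.pow_apply_one, hZ.pow_apply_g1, mul_zero, mul_zero, add_zero]

theorem pow_apply_g3 (k : ℕ) : (Z ^ (k + 4)) (g3 N) = 0 := by
  rw [pow_succ', hZ.mul_apply_g3, hZ.pow_apply_one, hZ.pow_apply_g1, hZ.pow_apply_g2]
  ring

theorem pow_apply_g4 (k : ℕ) : (Z ^ (k + 4)) (g4 N) = 0 := by
  rw [pow_succ', hZ.mul_apply_g4, hZ.pow_apply_one, hZ.pow_apply_g2]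
  ring

theorem pow_apply_g6 (k : ℕ) : (Z ^ (k + 5)) (g6 N) = 0 := by
  rw [pow_succ', hZ.mul_apply_g6, hZ.pow_apply_one, hZ.pow_apply_g1, hZ.pow_apply_g3]
  ring

theorem pow_apply_g7 (k : ℕ) : (Z ^ (k + 5)) (g7 N) = 0 := by
  rw [pow_succ', hZ.mul_apply_g7, hZ.pow_apply_one, hZ.pow_apply_g2, hZ.pow_apply_g3,
    hZ.pow_apply_g4]
  ring

theorem pow_apply_g8 (k : ℕ) : (Z ^ (k + 5)) (g8 N) = 0 := by
  rw [pow_succ', hZ.mul_apply_g8, hZ.pow_apply_one, hZ.pow_apply_g4]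
  ring

/-- The ladders and `1` span a subcoalgebra, so powers of `Z` on ladders see only the values of `Z`
on ladders. No closed formula for the exponential on arbitrary ladders is needed. -/
theorem pow_apply_gLadder_congr {Z' : WithConv (H3 N →ₗ[ℂ] Laurent)}
    (hZ' : IsInfinitesimalCharacter Z') {n : ℕ} (hn : n ∈ N)
    (h : ∀ k, Z (gLadder N hn k) = Z' (gLadder N hn k)) (j : ℕ) (k : Fin (n + 1)) :
    (Z ^ j) (gLadder N hn k) = (Z' ^ j) (gLadder N hn k) := by
  induction j generalizing k with
  | zero => rfl
  | succ j ih =>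
    have h1 : (Z ^ j) (1 : H3 N) = (Z' ^ j) (1 : H3 N) := by
      cases j with
      | zero => rfl
      | succ j => rw [hZ.pow_apply_one, hZ'.pow_apply_one]
    simp only [pow_succ', hZ.mul_apply_gLadder, hZ'.mul_apply_gLadder, ih, h, h1]

end IsInfinitesimalCharacter

open Filter in
theorem IsExp.apply_eq {χ : H3 N →ₐ[ℂ] Laurent} (hχ : IsExp Z χ) {x : H3 N} {m : ℕ}
    (hx : ∀ k, (Z ^ (k + m)) x = 0) :
    χ x = ∑ k ∈ Finset.range m, ((k.factorial : ℂ)⁻¹) • (Z ^ k) x := by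
  obtain ⟨n, hn⟩ := eventually_atTop.1 (hχ x)
  rw [← hn (n + m) (by omega), add_comm n m, Finset.sum_range_add, add_eq_left]
  exact Finset.sum_eq_zero fun k _ => by rw [add_comm, hx, smul_zero]

open Filter in
theorem IsExp.apply_gLadder_congr {Z' : WithConv (H3 N →ₗ[ℂ] Laurent)}
    {χ χ' : H3 N →ₐ[ℂ] Laurent} (hχ : IsExp Z χ) (hχ' : IsExp Z' χ')
    (hZ : IsInfinitesimalCharacter Z) (hZ' : IsInfinitesimalCharacter Z') {n : ℕ} (hn : n ∈ N)
    (h : ∀ k, Z (gLadder N hn k) = Z' (gLadder N hn k)) (k : Fin (n + 1)) :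
    χ (gLadder N hn k) = χ' (gLadder N hn k) := by
  obtain ⟨n, h1, h2⟩ := ((hχ (gLadder N hn k)).and (hχ' (gLadder N hn k))).exists
  rw [← h1, ← h2]
  simp only [hZ.pow_apply_gLadder_congr hZ' hn h]

variable {χ : H3 N →ₐ[ℂ] Laurent} (hχ : IsExp Z χ) (hZ : IsInfinitesimalCharacter Z)

include hχ hZ

/-- In this and the following formulas a monomial of degree `k` in `Z` comes from `Z^k / k!`: its
coefficient is `1 / k!` times the number of corresponding tensors in the iterated coproduct with a
single tree in each factor. -/
theorem IsExp.apply_g1 : χ (g1 N) = Z (g1 N) := by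
  rw [hχ.apply_eq hZ.pow_apply_g1]
  simp [Finset.sum_range_succ, counit_g1]

theorem IsExp.apply_g2 : χ (g2 N) = Z (g2 N) + (1 / 2 : ℂ) • (Z (g1 N) * Z (g1 N)) := by
  rw [hχ.apply_eq hZ.pow_apply_g2]
  simp [Finset.sum_range_succ, Nat.factorial, pow_succ', hZ.mul_apply_g2,
    counit_g2, hZ.apply_one]

theorem IsExp.apply_g3 : χ (g3 N) = Z (g3 N) + Z (g1 N) * Z (g2 N)
    + (1 / 6 : ℂ) • (Z (g1 N) * Z (g1 N) * Z (g1 N)) := by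
  rw [hχ.apply_eq hZ.pow_apply_g3]
  simp [Finset.sum_range_succ, Nat.factorial, pow_succ', hZ.mul_apply_g3, hZ.mul_apply_g2,
    hZ.mul_apply_g1, hZ.mul_apply_one, counit_g3,
    hZ.apply_one]
  algebra

theorem IsExp.apply_g4 : χ (g4 N) = Z (g4 N) + Z (g1 N) * Z (g2 N)
    + (1 / 3 : ℂ) • (Z (g1 N) * Z (g1 N) * Z (g1 N)) := by
  rw [hχ.apply_eq hZ.pow_apply_g4]
  simp [Finset.sum_range_succ, Nat.factorial, pow_succ', hZ.mul_apply_g4, hZ.mul_apply_g2,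
    hZ.mul_apply_one, counit_g4,
    hZ.apply_one]
  algebra

theorem IsExp.apply_g6 : χ (g6 N) = Z (g6 N) + (1 / 2 : ℂ) • (Z (g4 N) * Z (g1 N))
    + Z (g1 N) * Z (g3 N) + (2 / 3 : ℂ) • (Z (g1 N) * Z (g1 N) * Z (g2 N))
    + (1 / 12 : ℂ) • (Z (g1 N) * Z (g1 N) * (Z (g1 N) * Z (g1 N))) := by
  rw [hχ.apply_eq hZ.pow_apply_g6]
  simp [Finset.sum_range_succ, Nat.factorial, pow_succ', hZ.mul_apply_g6,
    hZ.mul_apply_g3, hZ.mul_apply_g2, hZ.mul_apply_g1, hZ.mul_apply_one, counit_g6, hZ.apply_one]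
  algebra

theorem IsExp.apply_g7 : χ (g7 N) = Z (g7 N) + (1 / 2 : ℂ) • (Z (g1 N) * Z (g4 N))
    + (1 / 2 : ℂ) • (Z (g1 N) * Z (g3 N)) + (1 / 2 : ℂ) • (Z (g2 N) * Z (g2 N))
    + (5 / 6 : ℂ) • (Z (g1 N) * Z (g1 N) * Z (g2 N))
    + (1 / 8 : ℂ) • (Z (g1 N) * Z (g1 N) * (Z (g1 N) * Z (g1 N))) := by
  rw [hχ.apply_eq hZ.pow_apply_g7]
  simp [Finset.sum_range_succ, Nat.factorial, pow_succ', hZ.mul_apply_g7, hZ.mul_apply_g4,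
    hZ.mul_apply_g3, hZ.mul_apply_g2, hZ.mul_apply_g1, hZ.mul_apply_one, counit_g7, hZ.apply_one]
  algebra

theorem IsExp.apply_g8 : χ (g8 N) = Z (g8 N) + (3 / 2 : ℂ) • (Z (g1 N) * Z (g4 N))
    + Z (g1 N) * Z (g1 N) * Z (g2 N)
    + (1 / 4 : ℂ) • (Z (g1 N) * Z (g1 N) * (Z (g1 N) * Z (g1 N))) := by
  rw [hχ.apply_eq hZ.pow_apply_g8]
  simp [Finset.sum_range_succ, Nat.factorial, pow_succ', hZ.mul_apply_g8, hZ.mul_apply_g4,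
    hZ.mul_apply_g2, hZ.mul_apply_one, counit_g8, hZ.apply_one]
  algebra

end Infinitesimal

/-! ### The Lax equation on the generators -/

theorem IsInfinitesimalCharacter.comp {K : Type} [CommRing K] [Bialgebra ℂ K]
    {Z : WithConv (K →ₗ[ℂ] Laurent)} (hZ : IsInfinitesimalCharacter Z)
    (T : Laurent →ₗ[ℂ] Laurent) :
    IsInfinitesimalCharacter (WithConv.toConv (T ∘ₗ Z.ofConv)) := fun x y => by
  change T (Z (x * y)) = _ • T (Z x) + _ • T (Z y)
  rw [hZ, map_add, map_smul, map_smul]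

/-- The bracket `x ⬝ R y - R x ⬝ y`, where `R = P₊ - P₋`. -/
noncomputable def rBracket (x y : Laurent) : Laurent :=
  x * (holPart y - polarPart y) - (holPart x - polarPart x) * y

/-- The products `x₋ y₋` and `x₊ y₊` cancel, leaving only the mixed terms. -/
theorem rBracket_eq (x y : Laurent) :
    rBracket x y = 2 * (polarPart x * holPart y - holPart x * polarPart y) := by
  have hx := polarPart_add_holPart x
  have hy := polarPart_add_holPart y
  rw [rBracket]
  linear_combination (-(holPart y - polarPart y)) * hx + (holPart x - polarPart x) * hy

theorem rBracket_add_smul_left (x x' y : Laurent) (c : ℂ) :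
    rBracket (x + c • x') y = rBracket x y + c • rBracket x' y := by
  simp only [rBracket, map_add, map_smul]
  algebra

theorem rBracket_add_smul_right (x y y' : Laurent) (c : ℂ) :
    rBracket x (y + c • y') = rBracket x y + c • rBracket x y' := by
  simp only [rBracket, map_add, map_smul]
  algebra

/-- In each mixed term one factor is holomorphic, so pole orders do not add up as they would in `x *
y`. This makes most terms of the flow harmless for locality. -/
theorem rBracket_mem {x y : Laurent} {n : ℤ} (hx : x ∈ poleLE n) (hy : y ∈ poleLE n) :
    rBracket x y ∈ poleLE n := by
  rw [rBracket_eq, two_mul]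
  have h := sub_mem (mul_mem_poleLE_of_eq (polarPart_mem hx) (holPart_mem y) (add_zero n))
    (mul_mem_poleLE_of_eq (holPart_mem x) (polarPart_mem hy) (zero_add n))
  exact add_mem h h

theorem eq_of_coeff_hasDerivAt {F : ℝ → Laurent} {e g : Laurent}
    (h : ∀ (t : ℝ) (k : ℤ),
      HasDerivAt (fun τ : ℝ => (F τ).coeff k) ((e + (t : ℂ) • g).coeff k) t) (t : ℝ) :
    F t = F 0 + (t : ℂ) • e + ((t : ℂ) ^ 2 / 2) • g := by
  refine Laurent.ext fun k => ?_
  have hd : ∀ τ : ℝ, HasDerivAt (fun τ : ℝ => (F τ).coeff k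
      - ((τ : ℂ) * e.coeff k + ((τ : ℂ) ^ 2 / 2) * g.coeff k)) 0 τ := by
    intro τ
    have h1 : HasDerivAt (fun τ : ℝ => (τ : ℂ)) 1 τ := Complex.ofRealCLM.hasDerivAt
    have h2 := (h τ k).sub ((h1.mul_const (e.coeff k)).add
      (((h1.pow 2).div_const 2).mul_const (g.coeff k)))
    refine h2.congr_deriv ?_
    simp only [Laurent.coeff_add, Laurent.coeff_smul]
    ring
  have hc := is_const_of_deriv_eq_zero (fun τ => (hd τ).differentiableAt)
    (fun τ => (hd τ).deriv) t 0
  simp only [Laurent.coeff_add, Laurent.coeff_smul]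
  simp only [Complex.ofReal_zero, zero_mul] at hc
  linear_combination hc

-- Explicit integration of the Lax equation on the generators.

namespace IsLaxSolution

variable {N : Set ℕ} {m n : ℤ} {L : ℝ → WithConv (H3 N →ₗ[ℂ] Laurent)}

/-- The power of `λ` disappears, and the factor `2` in `f(L)` cancels the `1/2` in `M`. -/
theorem laxM_eq (hmn : -n + 2 * m = 0) (Z : WithConv (H3 N →ₗ[ℂ] Laurent)) :
    laxM m n Z = WithConv.toConv ((holPart - polarPart) ∘ₗ Z.ofConv) := by
  refine conv_ext fun x => ?_
  have h : (laxM m n Z) x = (1 / 2 : ℂ) • (holPart - polarPart)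
      (Laurent.single (-n + 2 * m) 2 * Z x) := rfl
  rw [h, hmn, Laurent.single_zero, smul_mul_assoc, one_mul, map_smul, smul_smul]
  norm_num

variable (hL : IsLaxSolution m n L) (hmn : -n + 2 * m = 0)

include hL

theorem apply_eq_of_commutator {x : H3 N} {e g : Laurent}
    (h : ∀ t : ℝ, (L t * laxM m n (L t)) x - (laxM m n (L t) * L t) x = e + (t : ℂ) • g) (t : ℝ) :
    L t x = L 0 x + (t : ℂ) • e + ((t : ℂ) ^ 2 / 2) • g :=
  eq_of_coeff_hasDerivAt (fun t k => by
    rw [← h t]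
    exact hL.lax t x k) t

theorem apply_eq_of_commute {x : H3 N}
    (h : ∀ t : ℝ, (L t * laxM m n (L t)) x = (laxM m n (L t) * L t) x) (t : ℝ) :
    L t x = L 0 x := by
  simpa using hL.apply_eq_of_commutator (x := x) (e := 0) (g := 0)
    (fun t => by rw [h t]; simp) t

include hmn

theorem infinitesimal_laxM (t : ℝ) : IsInfinitesimalCharacter (laxM m n (L t)) := by
  rw [laxM_eq hmn]
  exact (hL.infinitesimal t).comp _

omit hL in
theorem laxM_apply (t : ℝ) (x : H3 N) :
    (laxM m n (L t)) x = holPart (L t x) - polarPart (L t x) := by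
  rw [laxM_eq hmn]
  rfl

theorem apply_g1 (t : ℝ) : L t (g1 N) = L 0 (g1 N) :=
  hL.apply_eq_of_commute (fun t => by
    have h1 := hL.infinitesimal t
    have h2 := hL.infinitesimal_laxM hmn t
    rw [h1.mul_apply_g1, h2.mul_apply_g1, h1.apply_one, h2.apply_one, mul_zero, mul_zero]) t

theorem apply_g2 (t : ℝ) : L t (g2 N) = L 0 (g2 N) :=
  hL.apply_eq_of_commute (fun t => by
    have h1 := hL.infinitesimal t
    have h2 := hL.infinitesimal_laxM hmn t
    rw [h1.mul_apply_g2, h2.mul_apply_g2, h1.apply_one, h2.apply_one]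
    ring) t

theorem apply_g3 (t : ℝ) : L t (g3 N) = L 0 (g3 N) :=
  hL.apply_eq_of_commute (fun t => by
    have h1 := hL.infinitesimal t
    have h2 := hL.infinitesimal_laxM hmn t
    rw [h1.mul_apply_g3, h2.mul_apply_g3, h1.apply_one, h2.apply_one]
    ring) t

theorem apply_gLadder (t : ℝ) {j : ℕ} (hj : j ∈ N) (k : Fin (j + 1)) :
    L t (gLadder N hj k) = L 0 (gLadder N hj k) :=
  hL.apply_eq_of_commute (fun t => by
    have h1 := hL.infinitesimal t
    have h2 := hL.infinitesimal_laxM hmn t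
    rw [h1.mul_apply_gLadder, h2.mul_apply_gLadder, h1.apply_one, h2.apply_one, mul_zero, mul_zero,
      zero_add, zero_add]
    -- The ladder coproduct is cocommutative: reversing the index exchanges the pruned part and the
    -- trunk, and the values commute.
    refine Fintype.sum_equiv Fin.revPerm _ _ fun i => ?_
    rw [mul_comm]
    congr 3 <;> exact Fin.ext (by simp only [Fin.revPerm_apply, Fin.val_rev]; omega)) t

/-- Here cocommutativity first fails: the linear part of the coproduct of `t₄` contains `2 t₁ ⊗ t₂`
without its mirror image. The derivative involves only the constant values on `t₁` and `t₂`. -/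
theorem apply_g4 (t : ℝ) : L t (g4 N)
    = L 0 (g4 N) + (t : ℂ) • (2 * rBracket (L 0 (g1 N)) (L 0 (g2 N))) := by
  rw [hL.apply_eq_of_commutator (x := g4 N)
    (e := 2 * rBracket (L 0 (g1 N)) (L 0 (g2 N))) (g := 0), smul_zero, add_zero]
  intro t
  have h1 := hL.infinitesimal t
  have h2 := hL.infinitesimal_laxM hmn t
  rw [h1.mul_apply_g4, h2.mul_apply_g4, h1.apply_one, h2.apply_one]
  simp only [laxM_apply hmn, hL.apply_g1 hmn t, hL.apply_g2 hmn t, rBracket]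
  simp only [smul_zero]
  ring

/-- The bracket is linear in the value on `t₄`, which is affine in `t`; so the derivative is affine
and integrates to a quadratic. The same holds for `t₇` and `t₈`. -/
theorem apply_g6 (t : ℝ) : L t (g6 N) = L 0 (g6 N)
    + (t : ℂ) • (rBracket (L 0 (g4 N)) (L 0 (g1 N)) + 2 * rBracket (L 0 (g1 N)) (L 0 (g3 N)))
    + ((t : ℂ) ^ 2 / 2) • rBracket (2 * rBracket (L 0 (g1 N)) (L 0 (g2 N))) (L 0 (g1 N)) := by
  refine hL.apply_eq_of_commutator (fun t => ?_) t
  have h1 := hL.infinitesimal t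
  have h2 := hL.infinitesimal_laxM hmn t
  have e := rBracket_add_smul_left (L 0 (g4 N)) (2 * rBracket (L 0 (g1 N)) (L 0 (g2 N)))
    (L 0 (g1 N)) t
  rw [← hL.apply_g4 hmn] at e
  rw [h1.mul_apply_g6, h2.mul_apply_g6, h1.apply_one, h2.apply_one, add_right_comm (rBracket _ _), ← e]
  simp only [laxM_apply hmn, hL.apply_g1 hmn t, hL.apply_g3 hmn t, rBracket]
  ring

theorem apply_g7 (t : ℝ) : L t (g7 N) = L 0 (g7 N)
    + (t : ℂ) • (rBracket (L 0 (g1 N)) (L 0 (g4 N)) + rBracket (L 0 (g1 N)) (L 0 (g3 N)))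
    + ((t : ℂ) ^ 2 / 2) • rBracket (L 0 (g1 N)) (2 * rBracket (L 0 (g1 N)) (L 0 (g2 N))) := by
  refine hL.apply_eq_of_commutator (fun t => ?_) t
  have h1 := hL.infinitesimal t
  have h2 := hL.infinitesimal_laxM hmn t
  have e := rBracket_add_smul_right (L 0 (g1 N)) (L 0 (g4 N))
    (2 * rBracket (L 0 (g1 N)) (L 0 (g2 N))) t
  rw [← hL.apply_g4 hmn] at e
  rw [h1.mul_apply_g7, h2.mul_apply_g7, h1.apply_one, h2.apply_one, add_right_comm (rBracket _ _), ← e]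
  simp only [laxM_apply hmn, hL.apply_g1 hmn t, hL.apply_g2 hmn t, hL.apply_g3 hmn t, rBracket]
  ring

theorem apply_g8 (t : ℝ) : L t (g8 N) = L 0 (g8 N)
    + (t : ℂ) • (3 * rBracket (L 0 (g1 N)) (L 0 (g4 N)))
    + ((t : ℂ) ^ 2 / 2) • (3 * rBracket (L 0 (g1 N))
      (2 * rBracket (L 0 (g1 N)) (L 0 (g2 N)))) := by
  refine hL.apply_eq_of_commutator (fun t => ?_) t
  have h1 := hL.infinitesimal t
  have h2 := hL.infinitesimal_laxM hmn t
  have e := rBracket_add_smul_right (L 0 (g1 N)) (L 0 (g4 N))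
    (2 * rBracket (L 0 (g1 N)) (L 0 (g2 N))) t
  rw [← hL.apply_g4 hmn] at e
  rw [h1.mul_apply_g8, h2.mul_apply_g8, h1.apply_one, h2.apply_one, ← mul_smul_comm, ← mul_add, ← e]
  simp only [laxM_apply hmn, hL.apply_g1 hmn t, rBracket]
  ring

end IsLaxSolution

/-! ### Necessary and sufficient conditions for locality -/

theorem polarPart_eq_zero {x : Laurent} (hx : x ∈ poleLE 0) : polarPart x = 0 :=
  polarPart_eq (zero_add x).symm polar.zero_mem hx

theorem polarPart_eq_self {x : Laurent} (hx : x ∈ polar) : polarPart x = x :=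
  polarPart_eq (add_zero x).symm hx (poleLE 0).zero_mem

theorem expSeries_mul_sub_polarPart_mem {x : Laurent} (hx : x ∈ poleLE 1) (c : ℂ) :
    expSeries c * x - polarPart x ∈ poleLE 0 := by
  have h := add_mem (expSeries_mul_sub_mem hx c) (holPart_mem x)
  have e : expSeries c * x - polarPart x = expSeries c * x - x + holPart x := by
    linear_combination -polarPart_add_holPart x
  rwa [e]

/-- To second order the left side is `(x + y)₊ + s λ (a x + b y)`. With double poles, the dependence
on `s` is thus holomorphic as soon as the weighted sum has at most a simple pole. -/
theorem expSeries_mul_add_expSeries_mul_sub_polarPart_mem {x y : Laurent} {a b : ℂ}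
    (hx : x ∈ poleLE 2) (hy : y ∈ poleLE 2) (h : a • x + b • y ∈ poleLE 1) (s : ℂ) :
    expSeries (s * a) * x + expSeries (s * b) * y - polarPart (x + y) ∈ poleLE 0 := by
  have h1 := add_mem (add_mem (expSeries_mul_sub_sub_mem hx (s * a))
    (expSeries_mul_sub_sub_mem hy (s * b))) (add_mem (holPart_mem (x + y))
      ((poleLE 0).smul_mem s (single_one_mul_mem_iff.2 h)))
  have e : expSeries (s * a) * x + expSeries (s * b) * y - polarPart (x + y)
      = expSeries (s * a) * x - x - (s * a) • (Laurent.single 1 1 * x)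
        + (expSeries (s * b) * y - y - (s * b) • (Laurent.single 1 1 * y))
        + (holPart (x + y) + s • (Laurent.single 1 1 * (a • x + b • y))) := by
    have := polarPart_add_holPart (x + y)
    simp only [mul_add, smul_add, mul_smul_comm, smul_smul]
    linear_combination -this
  rwa [e]

-- Rescaled characters and products of characters on the generators.

section Scale

variable {N : Set ℕ} (s : ℂ) (φ ψ : H3 N →ₐ[ℂ] Laurent)

theorem scale_treeGen (t : generators N) : scale s φ (treeGen (generators N) t)
    = expSeries (s * t.1.deg) * φ (treeGen (generators N) t) := by
  rw [scale, liftGen_treeGen]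

theorem deg_graft (l : List PlanarTree) :
    (RTree.graft (↑(l.map RTree.mk) : Multiset RTree)).deg
      = 1 + (l.map PlanarTree.size).sum := by
  rw [RTree.graft_map_mk]
  change PlanarTree.size _ = _
  rw [PlanarTree.size, PlanarTree.sizeList_eq]

theorem exists_mk (t : RTree) : ∃ p, RTree.mk p = t := ⟨t.out, RTree.mk_out t⟩

theorem deg_graft_zero : (RTree.graft 0).deg = 1 := deg_graft []

theorem deg_graft_one (a : RTree) : (RTree.graft {a}).deg = 1 + a.deg := by
  obtain ⟨p, rfl⟩ := exists_mk a
  exact deg_graft [p]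

theorem deg_graft_two (a b : RTree) : (RTree.graft {a, b}).deg = 1 + (a.deg + b.deg) := by
  obtain ⟨p, rfl⟩ := exists_mk a
  obtain ⟨q, rfl⟩ := exists_mk b
  exact deg_graft [p, q]

theorem deg_graft_three (a b c : RTree) :
    (RTree.graft {a, b, c}).deg = 1 + (a.deg + (b.deg + c.deg)) := by
  obtain ⟨p, rfl⟩ := exists_mk a
  obtain ⟨q, rfl⟩ := exists_mk b
  obtain ⟨r, rfl⟩ := exists_mk c
  exact deg_graft [p, q, r]

theorem deg_t1 : t1.deg = 1 := deg_graft_zero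
theorem deg_t2 : t2.deg = 2 := by rw [t2, deg_graft_one, deg_t1]
theorem deg_t3 : t3.deg = 3 := by rw [t3, deg_graft_one, deg_t2]
theorem deg_t4 : t4.deg = 3 := by rw [t4, deg_graft_two, deg_t1]
theorem deg_t6 : t6.deg = 4 := by rw [t6, deg_graft_one, deg_t4]
theorem deg_t7 : t7.deg = 4 := by rw [t7, deg_graft_two, deg_t1, deg_t2]
theorem deg_t8 : t8.deg = 4 := by rw [t8, deg_graft_three, deg_t1]

theorem scale_g1 : scale s φ (g1 N) = expSeries (s * 1) * φ (g1 N) := by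
  rw [g1, scale_treeGen, deg_t1, Nat.cast_one]
theorem scale_g2 : scale s φ (g2 N) = expSeries (s * 2) * φ (g2 N) := by
  rw [g2, scale_treeGen, deg_t2, Nat.cast_ofNat]
theorem scale_g3 : scale s φ (g3 N) = expSeries (s * 3) * φ (g3 N) := by
  rw [g3, scale_treeGen, deg_t3, Nat.cast_ofNat]
theorem scale_g4 : scale s φ (g4 N) = expSeries (s * 3) * φ (g4 N) := by
  rw [g4, scale_treeGen, deg_t4, Nat.cast_ofNat]
theorem scale_g6 : scale s φ (g6 N) = expSeries (s * 4) * φ (g6 N) := by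
  rw [g6, scale_treeGen, deg_t6, Nat.cast_ofNat]
theorem scale_g7 : scale s φ (g7 N) = expSeries (s * 4) * φ (g7 N) := by
  rw [g7, scale_treeGen, deg_t7, Nat.cast_ofNat]
theorem scale_g8 : scale s φ (g8 N) = expSeries (s * 4) * φ (g8 N) := by
  rw [g8, scale_treeGen, deg_t8, Nat.cast_ofNat]

theorem scale_zero : scale 0 φ = φ := by
  refine supported_algHom_ext fun t => ?_
  rw [scale_treeGen, zero_mul, expSeries_zero, one_mul]

/-- The convolution product of two characters, as a linear map. -/
noncomputable def charMul : WithConv (H3 N →ₗ[ℂ] Laurent) :=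
  WithConv.toConv ψ.toLinearMap * WithConv.toConv φ.toLinearMap

/-- The redundant factor `1` gives every term containing `φ` the shape expected by
`HasCoeffDeriv.exp_mul`. -/
theorem charMul_g1 : charMul φ ψ (g1 N) = ψ (g1 N) + 1 * φ (g1 N) := by
  rw [charMul, conv_mul_g1]
  simp

theorem charMul_g2 : charMul φ ψ (g2 N)
    = ψ (g2 N) + ψ (g1 N) * φ (g1 N) + 1 * φ (g2 N) := by
  rw [charMul, conv_mul_g2]
  simp

theorem charMul_g3 : charMul φ ψ (g3 N)
    = ψ (g3 N) + ψ (g2 N) * φ (g1 N) + ψ (g1 N) * φ (g2 N) + 1 * φ (g3 N) := by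
  rw [charMul, conv_mul_g3]
  simp

theorem charMul_g4 : charMul φ ψ (g4 N) = ψ (g4 N) + ψ (g1 N) * ψ (g1 N) * φ (g1 N)
    + 2 * ψ (g1 N) * φ (g2 N) + 1 * φ (g4 N) := by
  rw [charMul, conv_mul_g4]
  simp [mul_assoc]

theorem charMul_g6 : charMul φ ψ (g6 N) = ψ (g6 N) + ψ (g4 N) * φ (g1 N)
    + ψ (g1 N) * ψ (g1 N) * φ (g2 N) + 2 * ψ (g1 N) * φ (g3 N) + 1 * φ (g6 N) := by
  rw [charMul, conv_mul_g6]
  simp [mul_assoc]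

theorem charMul_g7 : charMul φ ψ (g7 N) = ψ (g7 N) + ψ (g1 N) * ψ (g2 N) * φ (g1 N)
    + ψ (g1 N) * ψ (g1 N) * φ (g2 N) + ψ (g2 N) * φ (g2 N) + ψ (g1 N) * φ (g3 N)
    + ψ (g1 N) * φ (g4 N) + 1 * φ (g7 N) := by
  rw [charMul, conv_mul_g7]
  simp

theorem charMul_g8 : charMul φ ψ (g8 N) = ψ (g8 N)
    + ψ (g1 N) * (ψ (g1 N) * ψ (g1 N)) * φ (g1 N) + 3 * (ψ (g1 N) * ψ (g1 N)) * φ (g2 N)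
    + 3 * ψ (g1 N) * φ (g4 N) + 1 * φ (g8 N) := by
  rw [charMul, conv_mul_g8]
  simp [mul_assoc]

theorem charMul_gLadder {n : ℕ} (hn : n ∈ N) (k : Fin (n + 1)) : charMul φ ψ (gLadder N hn k)
    = ψ (gLadder N hn k) + φ (gLadder N hn k)
      + ∑ i : Fin k, ψ (gLadder N hn ⟨i, by omega⟩) * φ (gLadder N hn ⟨k - 1 - i, by omega⟩) := by
  rw [charMul, conv_mul_gLadder]
  simp

/-- `ψ` is the counterterm of all the characters `φˢ`. -/
structure IsCounterterm : Prop where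
  polar : ∀ t, ψ (treeGen (generators N) t) ∈ polar
  holomorphic : ∀ s t, charMul (scale s φ) ψ (treeGen (generators N) t) ∈ poleLE 0

theorem isLocal_iff_exists_isCounterterm {φ : H3 N →ₐ[ℂ] Laurent} :
    IsLocal φ ↔ ∃ ψ, IsCounterterm φ ψ :=
  isLocal_iff.trans ⟨fun ⟨ψ, h1, h2⟩ => ⟨ψ, h1, h2⟩, fun ⟨ψ, h⟩ => ⟨ψ, h.1, h.2⟩⟩

end Scale

-- Pole conditions imposed by a counterterm, and their sufficiency.

namespace IsCounterterm

variable {N : Set ℕ} {φ ψ : H3 N →ₐ[ℂ] Laurent} (h : IsCounterterm φ ψ)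

include h

theorem holomorphic_zero (t : generators N) :
    charMul φ ψ (treeGen (generators N) t) ∈ poleLE 0 := by
  have := h.holomorphic 0 t
  rwa [scale_zero] at this

theorem add_mem_g1 : ψ (g1 N) + φ (g1 N) ∈ poleLE 0 := by
  have h0 : charMul φ ψ (g1 N) ∈ poleLE 0 := h.holomorphic_zero _
  rwa [charMul_g1, one_mul] at h0

theorem g1_mem : φ (g1 N) ∈ poleLE 1 := by
  have h' : ∀ s, charMul (scale s φ) ψ (g1 N) ∈ poleLE 0 := fun s => h.holomorphic s _
  simp only [charMul_g1, scale_g1] at h'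
  have hd := (HasCoeffDeriv.const (ψ (g1 N))).add (.exp_mul 1 (φ (g1 N)) 1)
  rw [zero_add] at hd
  simpa using hd.mem h'

/-- The derivative at `s = 0` of `ψ ⋆ φˢ` weights each term by the degree of its `φ` factor. The
conditions on the other trees arise in the same way. -/
theorem g2_mem : ψ (g1 N) * φ (g1 N) + 2 * φ (g2 N) ∈ poleLE 1 := by
  have h' : ∀ s, charMul (scale s φ) ψ (g2 N) ∈ poleLE 0 := fun s => h.holomorphic s _
  simp only [charMul_g2, scale_g2, scale_g1] at h'
  have hd := ((HasCoeffDeriv.const (ψ (g2 N))).add (.exp_mul 1 (φ (g1 N)) (ψ (g1 N)))).add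
    (.exp_mul 2 (φ (g2 N)) 1)
  rw [zero_add, ← mul_add] at hd
  convert hd.mem h' using 1
  algebra

theorem g3_mem : ψ (g2 N) * φ (g1 N) + 2 * ψ (g1 N) * φ (g2 N) + 3 * φ (g3 N) ∈ poleLE 1 := by
  have h' : ∀ s, charMul (scale s φ) ψ (g3 N) ∈ poleLE 0 := fun s => h.holomorphic s _
  simp only [charMul_g3, scale_g3, scale_g2, scale_g1] at h'
  have hd := (((HasCoeffDeriv.const (ψ (g3 N))).add (.exp_mul 1 (φ (g1 N)) (ψ (g2 N)))).add
    (.exp_mul 2 (φ (g2 N)) (ψ (g1 N)))).add (.exp_mul 3 (φ (g3 N)) 1)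
  rw [zero_add, ← mul_add, ← mul_add] at hd
  convert hd.mem h' using 1
  algebra

theorem g4_mem : ψ (g1 N) * ψ (g1 N) * φ (g1 N) + 4 * ψ (g1 N) * φ (g2 N) + 3 * φ (g4 N)
    ∈ poleLE 1 := by
  have h' : ∀ s, charMul (scale s φ) ψ (g4 N) ∈ poleLE 0 := fun s => h.holomorphic s _
  simp only [charMul_g4, scale_g4, scale_g2, scale_g1] at h'
  have hd := (((HasCoeffDeriv.const (ψ (g4 N))).add
    (.exp_mul 1 (φ (g1 N)) (ψ (g1 N) * ψ (g1 N)))).add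
    (.exp_mul 2 (φ (g2 N)) (2 * ψ (g1 N)))).add (.exp_mul 3 (φ (g4 N)) 1)
  rw [zero_add, ← mul_add, ← mul_add] at hd
  convert hd.mem h' using 1
  algebra

theorem g6_mem : ψ (g4 N) * φ (g1 N) + 2 * ψ (g1 N) * ψ (g1 N) * φ (g2 N)
    + 6 * ψ (g1 N) * φ (g3 N) + 4 * φ (g6 N) ∈ poleLE 1 := by
  have h' : ∀ s, charMul (scale s φ) ψ (g6 N) ∈ poleLE 0 := fun s => h.holomorphic s _
  simp only [charMul_g6, scale_g6, scale_g3, scale_g2, scale_g1] at h'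
  have hd := ((((HasCoeffDeriv.const (ψ (g6 N))).add (.exp_mul 1 (φ (g1 N)) (ψ (g4 N)))).add
    (.exp_mul 2 (φ (g2 N)) (ψ (g1 N) * ψ (g1 N)))).add
    (.exp_mul 3 (φ (g3 N)) (2 * ψ (g1 N)))).add (.exp_mul 4 (φ (g6 N)) 1)
  rw [zero_add, ← mul_add, ← mul_add, ← mul_add] at hd
  convert hd.mem h' using 1
  algebra

/-- Two local characters which agree on `t₁`, `t₂` and `t₃`. -/
theorem sub_mem_of_isCounterterm {χ ψ' : H3 N →ₐ[ℂ] Laurent} (h' : IsCounterterm χ ψ')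
    (e1 : χ (g1 N) = φ (g1 N)) (e2 : χ (g2 N) = φ (g2 N)) (e3 : χ (g3 N) = φ (g3 N)) :
    4 * (χ (g6 N) - φ (g6 N)) - (χ (g4 N) - φ (g4 N)) * φ (g1 N) ∈ poleLE 1 := by
  have eψ : ψ' (g1 N) = ψ (g1 N) := by
    refine sub_eq_zero.1 (eq_zero_of_mem_polar (sub_mem (h'.polar _) (h.polar _)) ?_)
    have := sub_mem h'.add_mem_g1 h.add_mem_g1
    rwa [e1, add_sub_add_right_eq_sub] at this
  have h6 := sub_mem h'.g6_mem h.g6_mem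
  have h4 : charMul χ ψ' (g4 N) - charMul φ ψ (g4 N) ∈ poleLE 0 :=
    sub_mem (h'.holomorphic_zero _) (h.holomorphic_zero _)
  rw [charMul_g4, charMul_g4, e1, e2, eψ] at h4
  rw [e1, e2, e3, eψ] at h6
  -- The difference of the counterterms on `t₄` is minus that of the characters, up to a holomorphic
  -- series; multiplying by the simple pole of `φ(t₁)` costs only a simple pole.
  have := sub_mem h6 (mul_mem_poleLE_of_eq h4 h.g1_mem (zero_add 1))
  convert this using 1
  ring

/-- Converse comparison. The coefficients `4` and `3` in `c6`, `c7`, `c8` are the degrees of the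
rescaled trees; `9` is the degree of `t₄` times the multiplicity of `t₁ ⊗ t₄` in the coproduct of
`t₈`. The term `d4 * φ(t₁)` of `c6` has weight one because there `d4` enters through the unscaled
counterterm. -/
theorem isLocal_of_sub_mem {χ : H3 N →ₐ[ℂ] Laurent}
    (e1 : χ (g1 N) = φ (g1 N)) (e2 : χ (g2 N) = φ (g2 N)) (e3 : χ (g3 N) = φ (g3 N))
    (el : ∀ n (hn : n ∈ N) k, χ (gLadder N hn k) = φ (gLadder N hn k))
    {d4 d6 d7 d8 : Laurent} (e4 : χ (g4 N) = φ (g4 N) + d4) (e6 : χ (g6 N) = φ (g6 N) + d6)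
    (e7 : χ (g7 N) = φ (g7 N) + d7) (e8 : χ (g8 N) = φ (g8 N) + d8)
    (h4 : d4 ∈ poleLE 1) (h6 : d6 ∈ poleLE 2) (h7 : d7 ∈ poleLE 2) (h8 : d8 ∈ poleLE 2)
    (c6 : 4 * d6 - d4 * φ (g1 N) ∈ poleLE 1) (c7 : 4 * d7 - 3 * (φ (g1 N) * d4) ∈ poleLE 1)
    (c8 : 4 * d8 - 9 * (φ (g1 N) * d4) ∈ poleLE 1) : IsLocal χ := by
  rw [isLocal_iff_exists_isCounterterm]
  have hφ1 := h.g1_mem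
  have hψ1 : ψ (g1 N) ∈ poleLE 1 := by
    simpa using sub_mem (poleLE_mono zero_le_one h.add_mem_g1) hφ1
  -- The counterterm is built in two stages by formulas uniform in the generator. `ψ1` already has
  -- the right values on `t₁, t₂, t₄` and the ladders. `ψ2` is Bogoliubov's recursion applied to
  -- `ψ1`; its formula on a tree uses `ψ1` only on proper branches, all of which belong to that
  -- list.
  set ψ1 : H3 N →ₐ[ℂ] Laurent := liftGen (generators N) fun t => ψ (treeGen (generators N) t)
    - polarPart (χ (treeGen (generators N) t) - φ (treeGen (generators N) t)) with hψ1_def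
  set ψ2 : H3 N →ₐ[ℂ] Laurent := liftGen (generators N) fun t =>
    -polarPart (charMul χ ψ1 (treeGen (generators N) t) - ψ1 (treeGen (generators N) t))
    with hψ2_def
  have f1 : ∀ t, ψ1 (treeGen (generators N) t) = ψ (treeGen (generators N) t)
      - polarPart (χ (treeGen (generators N) t) - φ (treeGen (generators N) t)) := fun t => by
    rw [hψ1_def, liftGen_treeGen]
  have f2 : ∀ t u, charMul χ ψ1 (treeGen (generators N) t) - ψ1 (treeGen (generators N) t)
      = charMul φ ψ (treeGen (generators N) t) - ψ (treeGen (generators N) t) + u →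
      ψ2 (treeGen (generators N) t) = ψ (treeGen (generators N) t) - polarPart u := fun t u hu => by
    rw [hψ2_def, liftGen_treeGen, hu, map_add, map_sub, polarPart_eq_zero (h.holomorphic_zero t),
      polarPart_eq_self (h.polar t)]
    ring
  have a1 : ψ1 (g1 N) = ψ (g1 N) := (f1 _).trans (by
    rw [show χ (treeGen (generators N) _) = φ (treeGen (generators N) _) from e1]
    simp only [sub_self, map_zero, sub_zero]
    rfl)
  have a2 : ψ1 (g2 N) = ψ (g2 N) := (f1 _).trans (by
    rw [show χ (treeGen (generators N) _) = φ (treeGen (generators N) _) from e2]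
    simp only [sub_self, map_zero, sub_zero]
    rfl)
  have a4 : ψ1 (g4 N) = ψ (g4 N) - polarPart d4 := (f1 _).trans (by
    rw [show χ (treeGen (generators N) _) = φ (treeGen (generators N) _) + d4 from e4]
    simp only [add_sub_cancel_left]
    rfl)
  have al : ∀ n (hn : n ∈ N) k, ψ1 (gLadder N hn k) = ψ (gLadder N hn k) := fun n hn k =>
    (f1 _).trans (by
      rw [show χ (treeGen (generators N) _) = φ (treeGen (generators N) _) from el n hn k]
      simp only [sub_self, map_zero, sub_zero]
      rfl)
  have b1 : ψ2 (g1 N) = ψ (g1 N) := (f2 _ 0 (by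
    change charMul χ ψ1 (g1 N) - ψ1 (g1 N) = charMul φ ψ (g1 N) - ψ (g1 N) + 0
    rw [charMul_g1, charMul_g1, e1]
    ring)).trans (by rw [map_zero, sub_zero]; rfl)
  have b2 : ψ2 (g2 N) = ψ (g2 N) := (f2 _ 0 (by
    change charMul χ ψ1 (g2 N) - ψ1 (g2 N) = charMul φ ψ (g2 N) - ψ (g2 N) + 0
    rw [charMul_g2, charMul_g2, e1, e2, a1]
    ring)).trans (by rw [map_zero, sub_zero]; rfl)
  have b3 : ψ2 (g3 N) = ψ (g3 N) := (f2 _ 0 (by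
    change charMul χ ψ1 (g3 N) - ψ1 (g3 N) = charMul φ ψ (g3 N) - ψ (g3 N) + 0
    rw [charMul_g3, charMul_g3, e1, e2, e3, a1, a2]
    ring)).trans (by rw [map_zero, sub_zero]; rfl)
  have bl : ∀ n (hn : n ∈ N) k, ψ2 (gLadder N hn k) = ψ (gLadder N hn k) := fun n hn k =>
    (f2 _ 0 (by
      change charMul χ ψ1 (gLadder N hn k) - ψ1 (gLadder N hn k)
        = charMul φ ψ (gLadder N hn k) - ψ (gLadder N hn k) + 0
      rw [charMul_gLadder, charMul_gLadder]
      simp only [el n hn, al n hn]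
      ring)).trans (by rw [map_zero, sub_zero]; rfl)
  have b4 : ψ2 (g4 N) = ψ (g4 N) - polarPart d4 := f2 _ d4 (by
    change charMul χ ψ1 (g4 N) - ψ1 (g4 N) = charMul φ ψ (g4 N) - ψ (g4 N) + d4
    rw [charMul_g4, charMul_g4, e1, e2, e4, a1]
    ring)
  have b6 : ψ2 (g6 N) = ψ (g6 N) - polarPart (-(polarPart d4 * φ (g1 N)) + d6) := f2 _ _ (by
    change charMul χ ψ1 (g6 N) - ψ1 (g6 N) = charMul φ ψ (g6 N) - ψ (g6 N) + _
    rw [charMul_g6, charMul_g6, e1, e2, e3, e6, a1, a4]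
    ring)
  have b7 : ψ2 (g7 N) = ψ (g7 N) - polarPart (ψ (g1 N) * d4 + d7) := f2 _ _ (by
    change charMul χ ψ1 (g7 N) - ψ1 (g7 N) = charMul φ ψ (g7 N) - ψ (g7 N) + _
    rw [charMul_g7, charMul_g7, e1, e2, e3, e4, e7, a1, a2]
    ring)
  have b8 : ψ2 (g8 N) = ψ (g8 N) - polarPart (3 * (ψ (g1 N) * d4) + d8) := f2 _ _ (by
    change charMul χ ψ1 (g8 N) - ψ1 (g8 N) = charMul φ ψ (g8 N) - ψ (g8 N) + _
    rw [charMul_g8, charMul_g8, e1, e2, e4, e8, a1]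
    ring)
  refine ⟨ψ2, fun t => ?_, fun s t => ?_⟩
  · rw [hψ2_def, liftGen_treeGen]
    exact neg_mem (polarPart_mem_polar _)
  have key : ∀ {x v : Laurent} (g : H3 N), charMul (scale s φ) ψ g ∈ poleLE 0 →
      x = charMul (scale s φ) ψ g + v → v ∈ poleLE 0 → x ∈ poleLE 0 :=
    fun g hg hx hv => hx ▸ add_mem hg hv
  have s1 : scale s χ (g1 N) = scale s φ (g1 N) := by rw [scale_g1, scale_g1, e1]
  have s2 : scale s χ (g2 N) = scale s φ (g2 N) := by rw [scale_g2, scale_g2, e2]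
  have s3 : scale s χ (g3 N) = scale s φ (g3 N) := by rw [scale_g3, scale_g3, e3]
  have s4 : scale s χ (g4 N) = scale s φ (g4 N) + expSeries (s * 3) * d4 := by
    rw [scale_g4, scale_g4, e4, mul_add]
  have sl : ∀ n (hn : n ∈ N) k, scale s χ (gLadder N hn k) = scale s φ (gLadder N hn k) :=
    fun n hn k => (scale_treeGen s χ _).trans
      ((congrArg (_ * ·) (el n hn k)).trans (scale_treeGen s φ _).symm)
  have two : ∀ {x : Laurent} {n : ℤ}, x ∈ poleLE n → 2 * x ∈ poleLE n := fun hx => by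
    rw [two_mul]; exact add_mem hx hx
  have three : ∀ {x : Laurent} {n : ℤ}, x ∈ poleLE n → 3 * x ∈ poleLE n := fun {x n} hx => by
    rw [show 3 * x = 2 * x + x by ring]; exact add_mem (two hx) hx
  have hψd : ψ (g1 N) * d4 ∈ poleLE 2 := mul_mem_poleLE hψ1 h4
  -- Modulo holomorphic series `ψ(t₁)` is `-φ(t₁)`; this converts `c7` and `c8` into weighted
  -- conditions on `ψ(t₁) d4`.
  have hhd : (ψ (g1 N) + φ (g1 N)) * d4 ∈ poleLE 1 :=
    mul_mem_poleLE_of_eq h.add_mem_g1 h4 (zero_add 1)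
  refine mem_generators_cases (P := fun x => charMul (scale s χ) ψ2 x ∈ poleLE 0)
    ?_ ?_ ?_ ?_ ?_ ?_ ?_ ?_ t
  · refine key (g1 N) (h.holomorphic s _) (v := 0) ?_ (poleLE 0).zero_mem
    rw [charMul_g1, charMul_g1, b1, s1, add_zero]
  · refine key (g2 N) (h.holomorphic s _) (v := 0) ?_ (poleLE 0).zero_mem
    rw [charMul_g2, charMul_g2, b1, b2, s1, s2, add_zero]
  · refine key (g3 N) (h.holomorphic s _) (v := 0) ?_ (poleLE 0).zero_mem
    rw [charMul_g3, charMul_g3, b1, b2, b3, s1, s2, s3, add_zero]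
  · refine key (g4 N) (h.holomorphic s _) ?_ (expSeries_mul_sub_polarPart_mem h4 (s * 3))
    rw [charMul_g4, charMul_g4, b1, b4, s1, s2, s4]
    ring
  · have hx : -(polarPart d4 * φ (g1 N)) ∈ poleLE 2 :=
      neg_mem (mul_mem_poleLE (polarPart_mem h4) hφ1)
    refine key (g6 N) (h.holomorphic s _) ?_
      (expSeries_mul_add_expSeries_mul_sub_polarPart_mem (a := 1) (b := 4)
      hx h6 ?_ s)
    · rw [charMul_g6, charMul_g6, b1, b4, b6, s1, s2, s3, scale_g6, scale_g6, scale_g1, e6]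
      ring
    -- Only the polar part of `d4` enters the counterterm; restoring its holomorphic part changes
    -- the sum by a simple pole.
    · have := add_mem c6 (mul_mem_poleLE_of_eq (holPart_mem d4) hφ1 (zero_add 1))
      have e : (1 : ℂ) • -(polarPart d4 * φ (g1 N)) + (4 : ℂ) • d6
          = 4 * d6 - (polarPart d4 + holPart d4) * φ (g1 N) + holPart d4 * φ (g1 N) := by
        algebra
      rwa [e, polarPart_add_holPart]
  · refine key (g7 N) (h.holomorphic s _) ?_
      (expSeries_mul_add_expSeries_mul_sub_polarPart_mem (a := 3) (b := 4)
      hψd h7 ?_ s)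
    · rw [charMul_g7, charMul_g7, b1, b2, b7, s1, s2, s3, s4, scale_g7, scale_g7, e7]
      ring
    · convert add_mem c7 (three hhd) using 1
      algebra
  · refine key (g8 N) (h.holomorphic s _) ?_
      (expSeries_mul_add_expSeries_mul_sub_polarPart_mem (a := 3) (b := 4)
      (three hψd) h8 ?_ s)
    · rw [charMul_g8, charMul_g8, b1, b8, s1, s2, s4, scale_g8, scale_g8, e8]
      ring
    · convert add_mem c8 (three (three hhd)) using 1
      algebra
  · intro n hn k
    refine key (gLadder N hn k) (h.holomorphic s _) (v := 0) ?_ (poleLE 0).zero_mem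
    rw [charMul_gLadder, charMul_gLadder]
    simp only [bl n hn, sl n hn, add_zero]

end IsCounterterm

/-! ### The obstruction to locality along the Lax flow -/

theorem eq_zero_iff_coeff_neg_one {x : Laurent} (hx : x ∈ polar) (hx' : x ∈ poleLE 1) :
    x = 0 ↔ x.coeff (-1) = 0 :=
  ⟨fun h => by rw [h, Laurent.coeff_zero], fun h => eq_zero_of_mem_polar hx
    (mem_poleLE_of_coeff_eq_zero (n := 0) (by simpa using hx') (by simpa using h))⟩

/-- The product has at most a double pole, so only its `λ⁻²` coefficient matters. It factors as `x₋₁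
(3 x₋₁ y₀ - y₋₁ x₀)`, where subscripts denote coefficients, and a polar series with a simple pole is
determined by its residue. -/
theorem obstruction_mem_iff {x y : Laurent} (hx : x ∈ poleLE 1) (hy : y ∈ poleLE 1) :
    polarPart x * ((3 : ℂ) • (polarPart x * holPart y) - polarPart y * holPart x) ∈ poleLE 1 ↔
      polarPart x = 0 ∨
        (3 * (holPart y).coeff 0) • polarPart x = (holPart x).coeff 0 • polarPart y := by
  have hx' := polarPart_mem hx
  have hy' := polarPart_mem hy
  have h1 := mul_mem_poleLE hx' (holPart_mem y)
  have h2 := mul_mem_poleLE hy' (holPart_mem x)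
  have h3 := sub_mem ((poleLE (1 + 0)).smul_mem 3 h1) h2
  have c1 := coeff_mul_of_mem hx' (holPart_mem y)
  have c2 := coeff_mul_of_mem hy' (holPart_mem x)
  have c := coeff_mul_of_mem hx' h3
  rw [Laurent.coeff_sub, Laurent.coeff_smul, c1, c2] at c
  simp only [neg_zero] at c
  have hm := mul_mem_poleLE hx' h3
  have e : polarPart x * ((3 : ℂ) • (polarPart x * holPart y) - polarPart y * holPart x) ∈ poleLE 1
      ↔ (polarPart x).coeff (-1) * (3 * ((polarPart x).coeff (-1) * (holPart y).coeff 0)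
        - (polarPart y).coeff (-1) * (holPart x).coeff 0) = 0 := by
    rw [← c]
    exact ⟨fun h => h _ (by norm_num), fun h => mem_poleLE_of_coeff_eq_zero
      (poleLE_mono (by norm_num) hm) h⟩
  rw [e, mul_eq_zero, ← eq_zero_iff_coeff_neg_one (polarPart_mem_polar x) hx', ← sub_eq_zero (b :=
    (holPart x).coeff 0 • polarPart y), eq_zero_iff_coeff_neg_one
    (sub_mem (polar.smul_mem _ (polarPart_mem_polar x)) (polar.smul_mem _ (polarPart_mem_polar y)))
    (sub_mem ((poleLE 1).smul_mem _ hx') ((poleLE 1).smul_mem _ hy')), Laurent.coeff_sub,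
    Laurent.coeff_smul, Laurent.coeff_smul]
  refine or_congr_right ?_
  constructor <;> intro h <;> linear_combination h

theorem natCast_mul_mem {x : Laurent} {n : ℤ} (hx : x ∈ poleLE n) (k : ℕ) :
    (k : Laurent) * x ∈ poleLE n := by
  rw [← nsmul_eq_mul]
  exact nsmul_mem hx k

theorem ofNat_mul_mem {x : Laurent} {n : ℤ} (hx : x ∈ poleLE n) (k : ℕ) [k.AtLeastTwo] :
    (ofNat(k) : Laurent) * x ∈ poleLE n := natCast_mul_mem hx k

theorem ofNat_mul_mem_iff {x : Laurent} {n : ℤ} (k : ℕ) [k.AtLeastTwo] :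
    (ofNat(k) : Laurent) * x ∈ poleLE n ↔ x ∈ poleLE n := by
  refine ⟨fun h => ?_, fun h => ofNat_mul_mem h k⟩
  have h' := (poleLE n).smul_mem ((k : ℂ)⁻¹) h
  have e : (ofNat(k) : Laurent) * x = (k : ℂ) • x := by
    rw [Nat.cast_smul_eq_nsmul, nsmul_eq_mul]
    rfl
  rwa [e, smul_smul, inv_mul_cancel₀ (NeZero.ne (k : ℂ)), one_smul] at h'

/-- The first order variation of the counterterms along the Lax flow, up to simple poles, is a
multiple of this Laurent series. -/
noncomputable def laxObstruction (x y w : Laurent) : Laurent :=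
  8 * (w * holPart x) + 2 * rBracket x y * x

theorem laxObstruction_mem_iff {x y w : Laurent} (hx : x ∈ poleLE 1) (hy : y ∈ poleLE 1)
    (hw : 3 * w - x * y ∈ poleLE 1) :
    laxObstruction x y w ∈ poleLE 1 ↔ polarPart x = 0 ∨
        (3 * (holPart y).coeff 0) • polarPart x = (holPart x).coeff 0 • polarPart y := by
  rw [← obstruction_mem_iff hx hy]
  have hx' := polarPart_mem hx
  have hy' := polarPart_mem hy
  have hP := holPart_mem x
  have hQ := holPart_mem y
  -- The terms with at most a simple pole: each contains at most one polar factor or the bounded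
  -- combination `3 w - x y`.
  have hR : 8 * ((3 * w - x * y) * holPart x) + 8 * (polarPart x * holPart y * holPart x)
      + 8 * (polarPart y * holPart x * holPart x) + 8 * (holPart x * holPart y * holPart x)
      + 12 * ((polarPart x * holPart y - polarPart y * holPart x) * holPart x) ∈ poleLE 1 := by
    have h1 := mul_mem_poleLE hx' hQ
    have h2 := mul_mem_poleLE hy' hP
    have h3 := poleLE_mono (by norm_num : (0 + 0 + 0 : ℤ) ≤ 1)
      (mul_mem_poleLE (mul_mem_poleLE hP hQ) hP)
    exact add_mem (add_mem (add_mem (add_mem (ofNat_mul_mem (mul_mem_poleLE hw hP) 8)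
      (ofNat_mul_mem (mul_mem_poleLE h1 hP) 8)) (ofNat_mul_mem (mul_mem_poleLE h2 hP) 8))
      (ofNat_mul_mem h3 8)) (ofNat_mul_mem (mul_mem_poleLE (sub_mem h1 h2) hP) 12)
  -- The factor `3` allows `3 w` to be replaced by `x y`. Then `8 x₋ y₋ x₊` combines with the `-12
  -- x₋ y₋ x₊` from the bracket to leave `-4 x₋ y₋ x₊`.
  have hr : 3 * laxObstruction x y w = 4 * (polarPart x * ((3 : ℂ) • (polarPart x * holPart y)
      - polarPart y * holPart x)) + (8 * ((3 * w - x * y) * holPart x)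
      + 8 * (polarPart x * holPart y * holPart x)
      + 8 * (polarPart y * holPart x * holPart x) + 8 * (holPart x * holPart y * holPart x)
      + 12 * ((polarPart x * holPart y - polarPart y * holPart x) * holPart x)) := by
    have ex := polarPart_add_holPart x
    have ey := polarPart_add_holPart y
    rw [laxObstruction, rBracket_eq]
    generalize polarPart x = a at *
    generalize polarPart y = b at *
    generalize holPart x = p at *
    generalize holPart y = q at *
    subst ex ey
    algebra
  rw [← ofNat_mul_mem_iff 3]
  change 3 * laxObstruction x y w ∈ _ ↔ _
  rw [hr]
  exact ((poleLE 1).add_mem_iff_left hR).trans (ofNat_mul_mem_iff 4)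

/-! ### Locality of a character in terms of its logarithm -/

section Logarithm

variable {N : Set ℕ} {φ ψ : H3 N →ₐ[ℂ] Laurent} {Z : WithConv (H3 N →ₗ[ℂ] Laurent)}
  (h : IsCounterterm φ ψ) (hφ : IsExp Z φ) (hZ : IsInfinitesimalCharacter Z)

include h hφ hZ

theorem IsCounterterm.log_g1_mem : Z (g1 N) ∈ poleLE 1 := hφ.apply_g1 hZ ▸ h.g1_mem

/-- Terms containing `ψ` are removed by subtracting holomorphic values of `ψ ⋆ φ` times a simple
pole. The same elimination serves for `t₃` and `t₄`, but on `t₄` the product `x y` remains, so the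
logarithm may have a double pole there. -/
theorem IsCounterterm.log_g2_mem : Z (g2 N) ∈ poleLE 1 := by
  have h0 := h.add_mem_g1
  have h2 := h.g2_mem
  rw [hφ.apply_g1 hZ] at h0
  rw [hφ.apply_g1 hZ, hφ.apply_g2 hZ] at h2
  rw [← ofNat_mul_mem_iff 2]
  convert sub_mem h2 (mul_mem_poleLE_of_eq h0 (h.log_g1_mem hφ hZ) (zero_add 1)) using 1
  algebra

theorem IsCounterterm.log_g3_mem : Z (g3 N) ∈ poleLE 1 := by
  have h0 := h.add_mem_g1
  have h2 : charMul φ ψ (g2 N) ∈ poleLE 0 := h.holomorphic_zero _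
  have h3 := h.g3_mem
  rw [charMul_g2, hφ.apply_g1 hZ, hφ.apply_g2 hZ] at h2
  rw [hφ.apply_g1 hZ] at h0
  rw [hφ.apply_g1 hZ, hφ.apply_g2 hZ, hφ.apply_g3 hZ] at h3
  rw [← ofNat_mul_mem_iff 3]
  convert sub_mem (sub_mem h3 (mul_mem_poleLE_of_eq h2 (h.log_g1_mem hφ hZ) (zero_add 1)))
    (ofNat_mul_mem (mul_mem_poleLE_of_eq h0 (h.log_g2_mem hφ hZ) (zero_add 1)) 2) using 1
  algebra

theorem IsCounterterm.log_g4_mem : 3 * Z (g4 N) - Z (g1 N) * Z (g2 N) ∈ poleLE 1 := by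
  have h0 := h.add_mem_g1
  have h4 := h.g4_mem
  rw [hφ.apply_g1 hZ] at h0
  rw [hφ.apply_g1 hZ, hφ.apply_g2 hZ, hφ.apply_g4 hZ] at h4
  convert sub_mem (sub_mem h4 (mul_mem_poleLE_of_eq (mul_mem_poleLE h0 h0)
    (h.log_g1_mem hφ hZ) (zero_add 1)))
    (ofNat_mul_mem (mul_mem_poleLE_of_eq h0 (h.log_g2_mem hφ hZ) (zero_add 1)) 4) using 1
  algebra

end Logarithm

/-! ### Locality along the Lax flow -/

theorem rBracket_swap (x y : Laurent) : rBracket y x = -rBracket x y := by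
  rw [rBracket, rBracket]
  ring

/-- The only contribution that can exceed a simple pole is `2 w₋ x₊`, and replacing `w₋` by `w` adds
a holomorphic term. -/
theorem rBracket_sub_two_mul_mem {x w : Laurent} (hx : x ∈ poleLE 1) :
    rBracket w x - 2 * (w * holPart x) ∈ poleLE 1 := by
  have e : rBracket w x - 2 * (w * holPart x)
      = -(2 * (holPart w * holPart x)) - 2 * (holPart w * polarPart x) := by
    rw [rBracket_eq]
    linear_combination 2 * holPart x * polarPart_add_holPart w
  rw [e]
  exact sub_mem (neg_mem (ofNat_mul_mem (poleLE_mono (by norm_num)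
    (mul_mem_poleLE (holPart_mem w) (holPart_mem x))) 2))
    (ofNat_mul_mem (mul_mem_poleLE_of_eq (holPart_mem w) (polarPart_mem hx) (zero_add 1)) 2)

theorem mem_poleLE_two {x y w : Laurent} (hx : x ∈ poleLE 1) (hy : y ∈ poleLE 1)
    (hw : 3 * w - x * y ∈ poleLE 1) : w ∈ poleLE 2 := by
  have := add_mem (poleLE_mono (by norm_num) hw) (mul_mem_poleLE hx hy)
  rw [sub_add_cancel] at this
  exact (ofNat_mul_mem_iff 3).1 this

section Flow

variable {N : Set ℕ} {m n : ℤ} {L : ℝ → WithConv (H3 N →ₗ[ℂ] Laurent)}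
  {χ : ℝ → (H3 N →ₐ[ℂ] Laurent)} (hL : IsLaxSolution m n L) (hmn : -n + 2 * m = 0)
  (hχ : ∀ t, IsExp (L t) (χ t))

include hL hmn hχ

theorem flow_g1 (t : ℝ) : χ t (g1 N) = χ 0 (g1 N) := by
  rw [(hχ t).apply_g1 (hL.infinitesimal t), (hχ 0).apply_g1 (hL.infinitesimal 0),
    hL.apply_g1 hmn]

theorem flow_g2 (t : ℝ) : χ t (g2 N) = χ 0 (g2 N) := by
  rw [(hχ t).apply_g2 (hL.infinitesimal t), (hχ 0).apply_g2 (hL.infinitesimal 0),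
    hL.apply_g1 hmn, hL.apply_g2 hmn]

theorem flow_g3 (t : ℝ) : χ t (g3 N) = χ 0 (g3 N) := by
  rw [(hχ t).apply_g3 (hL.infinitesimal t), (hχ 0).apply_g3 (hL.infinitesimal 0),
    hL.apply_g1 hmn, hL.apply_g2 hmn, hL.apply_g3 hmn]

theorem flow_gLadder (t : ℝ) {j : ℕ} (hj : j ∈ N) (k : Fin (j + 1)) :
    χ t (gLadder N hj k) = χ 0 (gLadder N hj k) :=
  (hχ t).apply_gLadder_congr (hχ 0) (hL.infinitesimal t) (hL.infinitesimal 0) hj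
    (hL.apply_gLadder hmn t hj) k

theorem flow_g4 (t : ℝ) : χ t (g4 N)
    = χ 0 (g4 N) + (t : ℂ) • (2 * rBracket (L 0 (g1 N)) (L 0 (g2 N))) := by
  rw [(hχ t).apply_g4 (hL.infinitesimal t), (hχ 0).apply_g4 (hL.infinitesimal 0),
    hL.apply_g1 hmn t, hL.apply_g2 hmn t, hL.apply_g4 hmn t]
  ring

theorem flow_g6 (t : ℝ) : χ t (g6 N) = χ 0 (g6 N)
    + ((t : ℂ) • (rBracket (L 0 (g4 N)) (L 0 (g1 N)) + 2 * rBracket (L 0 (g1 N)) (L 0 (g3 N)))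
    + ((t : ℂ) ^ 2 / 2) • rBracket (2 * rBracket (L 0 (g1 N)) (L 0 (g2 N))) (L 0 (g1 N))
    + ((t : ℂ) / 2) • (2 * rBracket (L 0 (g1 N)) (L 0 (g2 N)) * L 0 (g1 N))) := by
  rw [(hχ t).apply_g6 (hL.infinitesimal t), (hχ 0).apply_g6 (hL.infinitesimal 0),
    hL.apply_g1 hmn t, hL.apply_g2 hmn t, hL.apply_g3 hmn t, hL.apply_g4 hmn t, hL.apply_g6 hmn t]
  algebra

theorem flow_g7 (t : ℝ) : χ t (g7 N) = χ 0 (g7 N)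
    + ((t : ℂ) • (rBracket (L 0 (g1 N)) (L 0 (g4 N)) + rBracket (L 0 (g1 N)) (L 0 (g3 N)))
    + ((t : ℂ) ^ 2 / 2) • rBracket (L 0 (g1 N)) (2 * rBracket (L 0 (g1 N)) (L 0 (g2 N)))
    + ((t : ℂ) / 2) • (2 * rBracket (L 0 (g1 N)) (L 0 (g2 N)) * L 0 (g1 N))) := by
  rw [(hχ t).apply_g7 (hL.infinitesimal t), (hχ 0).apply_g7 (hL.infinitesimal 0),
    hL.apply_g1 hmn t, hL.apply_g2 hmn t, hL.apply_g3 hmn t, hL.apply_g4 hmn t, hL.apply_g7 hmn t]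
  algebra

theorem flow_g8 (t : ℝ) : χ t (g8 N) = χ 0 (g8 N)
    + ((t : ℂ) • (3 * rBracket (L 0 (g1 N)) (L 0 (g4 N)))
    + ((t : ℂ) ^ 2 / 2) • (3 * rBracket (L 0 (g1 N))
      (2 * rBracket (L 0 (g1 N)) (L 0 (g2 N))))
    + (3 * (t : ℂ) / 2) • (2 * rBracket (L 0 (g1 N)) (L 0 (g2 N)) * L 0 (g1 N))) := by
  rw [(hχ t).apply_g8 (hL.infinitesimal t), (hχ 0).apply_g8 (hL.infinitesimal 0),
    hL.apply_g1 hmn t, hL.apply_g2 hmn t, hL.apply_g4 hmn t, hL.apply_g8 hmn t]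
  algebra

/-- Along the Lax flow of a local character, locality is preserved if and only if the obstruction
has at most a simple pole. -/
theorem isLocal_flow_iff {ψ : H3 N →ₐ[ℂ] Laurent} (h : IsCounterterm (χ 0) ψ) :
    (∀ t, IsLocal (χ t)) ↔
      laxObstruction (L 0 (g1 N)) (L 0 (g2 N)) (L 0 (g4 N)) ∈ poleLE 1 := by
  have hx := h.log_g1_mem (hχ 0) (hL.infinitesimal 0)
  have hy := h.log_g2_mem (hχ 0) (hL.infinitesimal 0)
  have hz := h.log_g3_mem (hχ 0) (hL.infinitesimal 0)
  have hw := h.log_g4_mem (hχ 0) (hL.infinitesimal 0)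
  have e1 := (hχ 0).apply_g1 (hL.infinitesimal 0)
  have h4 := flow_g4 hL hmn hχ
  have h6 := flow_g6 hL hmn hχ
  have h7 := flow_g7 hL hmn hχ
  have h8 := flow_g8 hL hmn hχ
  rw [laxObstruction]
  generalize L 0 (g1 N) = x at *
  generalize L 0 (g2 N) = y at *
  generalize L 0 (g3 N) = z at *
  generalize L 0 (g4 N) = w at *
  have hw2 := mem_poleLE_two hx hy hw
  have hx2 := poleLE_mono (by norm_num : (1 : ℤ) ≤ 2) hx
  have hB := rBracket_sub_two_mul_mem (w := w) hx
  have hC : 2 * rBracket x y ∈ poleLE 1 := ofNat_mul_mem (rBracket_mem hx hy) 2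
  have hxz := rBracket_mem hx hz
  have hCx := rBracket_mem hC hx
  have hxC := rBracket_mem hx hC
  have hCx2 := mul_mem_poleLE hC hx
  have hwx := rBracket_mem hw2 hx2
  have hxw := rBracket_mem hx2 hw2
  have hup : ∀ {v : Laurent}, v ∈ poleLE 1 → v ∈ poleLE 2 := fun hv =>
    poleLE_mono (by norm_num) hv
  have hswap := rBracket_swap w x
  generalize 2 * rBracket x y = C at *
  constructor
  · intro hloc
    -- Locality at the single time `1`, tested on the single tree `t₆`, already forces the
    -- condition.
    obtain ⟨ψ', h'⟩ := isLocal_iff_exists_isCounterterm.1 (hloc 1)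
    have key := h.sub_mem_of_isCounterterm h' (flow_g1 hL hmn hχ 1) (flow_g2 hL hmn hχ 1)
      (flow_g3 hL hmn hχ 1)
    rw [h4, h6, e1, add_sub_cancel_left, add_sub_cancel_left] at key
    -- The subtracted terms are the harmless ones: the correction to `2 w x₊`, the bracket with `z`,
    -- and the quadratic term in time.
    have := sub_mem (sub_mem (sub_mem key (ofNat_mul_mem hB 4)) (ofNat_mul_mem hxz 8))
      (ofNat_mul_mem hCx 2)
    convert this using 1
    simp only [Complex.ofReal_one]
    algebra
  · intro hO t
    refine h.isLocal_of_sub_mem (flow_g1 hL hmn hχ t) (flow_g2 hL hmn hχ t) (flow_g3 hL hmn hχ t)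
      (fun n hn => flow_gLadder hL hmn hχ t hn) (h4 t) (h6 t) (h7 t) (h8 t)
      ((poleLE 1).smul_mem _ hC) ?_ ?_ ?_ ?_ ?_ ?_
    · exact add_mem (add_mem ((poleLE 2).smul_mem _ (add_mem hwx (ofNat_mul_mem (hup hxz) 2)))
        ((poleLE 2).smul_mem _ (hup hCx))) ((poleLE 2).smul_mem _ hCx2)
    · exact add_mem (add_mem ((poleLE 2).smul_mem _ (add_mem hxw (hup hxz)))
        ((poleLE 2).smul_mem _ (hup hxC))) ((poleLE 2).smul_mem _ hCx2)
    · exact add_mem (add_mem ((poleLE 2).smul_mem _ (ofNat_mul_mem hxw 3))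
        ((poleLE 2).smul_mem _ (ofNat_mul_mem (hup hxC) 3))) ((poleLE 2).smul_mem _ hCx2)
    · rw [e1]
      convert add_mem (add_mem (add_mem ((poleLE 1).smul_mem (t : ℂ) hO)
        ((poleLE 1).smul_mem (4 * (t : ℂ)) hB)) ((poleLE 1).smul_mem (8 * (t : ℂ)) hxz))
        ((poleLE 1).smul_mem (2 * (t : ℂ) ^ 2) hCx) using 1
      algebra
    -- On `t₇` the bracket of `x` and `w` occurs in the opposite order, so the obstruction returns
    -- with the factor `-t`; on `t₈` the factor is `-3 t`.
    · rw [e1, hswap]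
      convert add_mem (add_mem (add_mem ((poleLE 1).smul_mem (-(t : ℂ)) hO)
        ((poleLE 1).smul_mem (-4 * (t : ℂ)) hB)) ((poleLE 1).smul_mem (4 * (t : ℂ)) hxz))
        ((poleLE 1).smul_mem (2 * (t : ℂ) ^ 2) hxC) using 1
      algebra
    · rw [e1, hswap]
      convert add_mem (add_mem ((poleLE 1).smul_mem (-3 * (t : ℂ)) hO)
        ((poleLE 1).smul_mem (-12 * (t : ℂ)) hB))
        ((poleLE 1).smul_mem (6 * (t : ℂ) ^ 2) hxC) using 1
      algebra

end Flow

/-! ### The Birkhoff decomposition on the normal coordinates -/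

section Birkhoff

variable {N : Set ℕ} {φ φm φp : H3 N →ₐ[ℂ] Laurent} (hB : IsBirkhoff φ φm φp)

include hB

theorem IsBirkhoff.apply_eq (x : H3 N) : φp x = charMul φ φm x :=
  (congrArg (fun f : WithConv (H3 N →ₐ[ℂ] Laurent) => f x) hB.factor).symm

theorem IsBirkhoff.polarPart_holPart {x : H3 N} {a : Laurent}
    (hx : Coalgebra.counit (R := ℂ) x = 0) (ha : φp x = φm x + a) :
    polarPart a = -φm x ∧ holPart a = φp x := by
  have e : a = -φm x + φp x := by rw [ha]; ring
  have h0 : φm x ∈ TreeHopf.polar := hB.polar x hx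
  have h1 : -φm x ∈ TreeHopf.polar := neg_mem h0
  have h2 : φp x ∈ poleLE 0 := fun k hk => hB.holomorphic x k (by simpa using hk)
  exact ⟨polarPart_eq e h1 h2, holPart_eq e h1 h2⟩

variable {Z : WithConv (H3 N →ₗ[ℂ] Laurent)} (hφ : IsExp Z φ) (hZ : IsInfinitesimalCharacter Z)

include hφ hZ

theorem IsBirkhoff.log_g1 :
    polarPart (Z (g1 N)) = -φm (f1 N) ∧ holPart (Z (g1 N)) = φp (f1 N) := by
  refine hB.polarPart_holPart counit_g1 ?_
  have := hB.apply_eq (g1 N)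
  rwa [charMul_g1, one_mul, hφ.apply_g1 hZ] at this

/-- Subtracting `t₁² / 2` cancels `t₁ ⊗ t₁` in the coproduct of `t₂`, so `f₂` is primitive. The
logarithm on `t₂` equals `φ(f₂)`, and the Birkhoff decomposition is additive there. -/
theorem IsBirkhoff.log_g2 :
    polarPart (Z (g2 N)) = -φm (f2 N) ∧ holPart (Z (g2 N)) = φp (f2 N) := by
  have ef : f2 N = g2 N - (1 / 2 : ℂ) • (g1 N * g1 N) := rfl
  refine hB.polarPart_holPart ?_ ?_
  · rw [ef, map_sub, map_smul, Bialgebra.counit_mul, counit_g1, counit_g2]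
    simp
  · have h1 := hB.apply_eq (g1 N)
    have h2 := hB.apply_eq (g2 N)
    rw [charMul_g1, hφ.apply_g1 hZ] at h1
    rw [charMul_g2, hφ.apply_g1 hZ, hφ.apply_g2 hZ] at h2
    simp only [ef, map_sub, map_smul, map_mul, h1, h2]
    algebra

end Birkhoff

end TreeHopf

theorem proposition7p13 (N : Set ℕ) (m n : ℤ) (hmn : -n + 2 * m = 0)
    (φ φm φp : TreeHopf.H3 N →ₐ[ℂ] TreeHopf.Laurent)
    (hφ : TreeHopf.IsLocal φ) (hB : TreeHopf.IsBirkhoff φ φm φp)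
    (L : ℝ → WithConv (TreeHopf.H3 N →ₗ[ℂ] TreeHopf.Laurent))
    (hL : TreeHopf.IsLaxSolution m n L) (hL0 : TreeHopf.IsLog φ (L 0))
    (χ : ℝ → (TreeHopf.H3 N →ₐ[ℂ] TreeHopf.Laurent))
    (hχ : ∀ t : ℝ, TreeHopf.IsExp (L t) (χ t)) :
    (∀ t : ℝ, TreeHopf.IsLocal (χ t)) ↔
      (φm (TreeHopf.f1 N) = 0 ∨
        3 * φm (TreeHopf.f1 N) * algebraMap ℂ TreeHopf.Laurent ((φp (TreeHopf.f2 N)).coeff 0)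
          = φm (TreeHopf.f2 N) * algebraMap ℂ TreeHopf.Laurent ((φp (TreeHopf.f1 N)).coeff 0)) := by
  have h0 : χ 0 = φ := TreeHopf.eq_of_isLog_of_isExp hL0 (hχ 0)
  obtain ⟨ψ, h⟩ := TreeHopf.isLocal_iff_exists_isCounterterm.1 hφ
  rw [← h0] at h hB
  have hZ := hL.infinitesimal 0
  obtain ⟨a1, p1⟩ := hB.log_g1 (hχ 0) hZ
  obtain ⟨a2, p2⟩ := hB.log_g2 (hχ 0) hZ
  rw [TreeHopf.isLocal_flow_iff hL hmn hχ h, TreeHopf.laxObstruction_mem_iff (h.log_g1_mem (hχ 0) hZ)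
    (h.log_g2_mem (hχ 0) hZ) (h.log_g4_mem (hχ 0) hZ), a1, a2, p1, p2, neg_eq_zero, smul_neg,
    smul_neg, neg_inj]
  -- The minus signs of both polar parts have cancelled; what remains is to write scalar multiples
  -- as products with constant series.
  refine or_congr_right (Eq.congr ?_ ?_) <;> algebra
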